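/- Let $k$ be a perfect field of characteristic $p>0$, let $W=W(k)$ be its ring of Witt vectors, $\sigma$ the Frobenius automorphism of $W$, and, for a $W$-module $M$, put $M^*=\mathrm{Hom}_W(M,W)$. An $F$-crystal $(M,F)$ over $k$ is a free $W$-module $M$ of finite rank with an injective $\sigma$-linear map $F:M\to M$. Its Hodge slopes are the integers $0\le a_1\le\cdots\le a_n$ ($n=\mathrm{rank}\,M$) for which there are $W$-bases $(v_i)$, $(w_i)$ of $M$ with $F(v_i)=p^{a_i}w_i$. Let $k'$ be an algebraic closure of $k$, $K'=\mathrm{Frac}\,W(k')$, and for coprime integers $s$ and $r>0$ let $V_{s/r}=K'[T]/(T^r-p^s)$ with the $\sigma$-linear map $x\mapsto T\cdot\sigma(x)$, where $\sigma$ acts on coefficients. The Newton slopes of $(M,F)$ are the rational numbers $\lambda_1\le\cdots\le\lambda_n$ obtained from an isomorphism $(M\otimes_W K',F\otimes\sigma)\cong\bigoplus_i V_{s_i/r_i}$ by listing each $s_i/r_i$ with multiplicity $r_i$. The Hodge (resp. Newton) polygon is the piecewise linear graph over $[0,n]$ through $(0,0)$ and the points $(i,a_1+\cdots+a_i)$ (resp.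 $(i,\lambda_1+\cdots+\lambda_i)$), $1\le i\le n$. A break point is a point of the polygon with abscissa strictly between $0$ and $n$ at which the slope changes. A self-dual $F$-crystal over $k$ is a quintuple $(M,F_M,F_{M^*},\Psi,c)$ where $0\ne c\in W$, $(M,F_M)$ and $(M^*,F_{M^*})$ are $F$-crystals over $k$, $F_{M^*}\circ F_M^*=c\cdot\mathrm{id}$ and $F_M^*\circ F_{M^*}=\sigma^{-1}(c)\cdot\mathrm{id}$ with $F_M^*(\varphi)=\sigma^{-1}\circ\varphi\circ F_M$, and $\Psi:(M,F_M)\to(M^*,F_{M^*})$ is an isomorphism of $F$-crystals, i.e. a $W$-linear isomorphism with $\Psi\circ F_M=F_{M^*}\circ\Psi$. Its slopes and polygons are those of $(M,F_M)$. **Theorem (Newton-Hodge decomposition for self-dual $F$-crystals).** Let $(M,F_M,F_{M^*},\Psi,c)$ be a self-dual $F$-crystal of rank $n$ over $k$, with Newton slopes $\lambda_1\le\cdots\le\lambda_n$ and Hodge slopes $a_1\le\cdots\le a_n$. Let $(A,B)\in\mathbb Z\times\mathbb Z$ be a break point of its Newton polygon which also lies on its Hodge polygon, and assume $A<\frac n2$.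 Then there is a decomposition $$(M,F_M)=(M_{S_1}\oplus M_{S_2},\,F_{S_1}\oplus F_{S_2})$$ into two $F$-stable submodules underlying self-dual $F$-crystals $(M_{S_i},F_{S_i},F_{M_{S_i}^*},\Psi_{S_i},c)$, $i=1,2$, with the same constant $c$, such that 1. $M_{S_1}$ has rank $2A$, and the Hodge and the Newton slopes of $(M_{S_1},F_{S_1})$ are $a_1\le\cdots\le a_A\le a_{n-A+1}\le\cdots\le a_n$ and $\lambda_1\le\cdots\le\lambda_A\le\lambda_{n-A+1}\le\cdots\le\lambda_n$; 2. $M_{S_2}$ has rank $n-2A$, and the Hodge and the Newton slopes of $(M_{S_2},F_{S_2})$ are $a_{A+1}\le\cdots\le a_{n-A}$ and $\lambda_{A+1}\le\cdots\le\lambda_{n-A}$. The self-dual structures can be chosen so that $\Psi_{S_i}$ is the restriction of $\Psi$ to $M_{S_i}$, and $M_{S_1}$, $M_{S_2}$ are orthogonal to each other for $\Psi$ (on both sides). The pair of submodules $(M_{S_1},M_{S_2})$ is unique: it is the only pair for which there is such a decomposition, with any self-dual structures with constant $c$ extending the restrictions of $F_M$. Moreover, there are $F_M$-stable submodules $M_1\subset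 M_2\subset M$, direct summands of the $W$-module $M$ of ranks $A$ and $n-A$, such that the Newton slopes of $(M_1,F_M|_{M_1})$ are $\lambda_1,\dots,\lambda_A$, those of $(M_2,F_M|_{M_2})$ are $\lambda_1,\dots,\lambda_{n-A}$, and $M_1$, $M_2$ are perpendicular: $\Psi(m_1)(m_2)=\Psi(m_2)(m_1)=0$ for all $m_1\in M_1$, $m_2\in M_2$. -/

import Mathlib

open scoped TensorProduct Polynomial

noncomputable section

namespace NewtonHodge

/-- The Frobenius `σ` of the ring of Witt vectors `W(k)`. -/
abbrev wittFrob (p : ℕ) [Fact p.Prime] (k : Type*) [CommRing k] :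
    WittVector p k →+* WittVector p k :=
  WittVector.frobenius

/-! ### `F`-crystals and self-dual `F`-crystals -/

/-- An `F`-crystal over the perfect field `k` with underlying module `M`: the `W(k)`-module `M` is
free of finite rank, and `F : M → M` is an injective `σ`-linear map. -/
structure FCrystal (p : ℕ) [Fact p.Prime] (k : Type*) [Field k] [CharP k p] [PerfectRing k p]
    (M : Type*) [AddCommGroup M] [Module (WittVector p k) M] where
  free : Module.Free (WittVector p k) M
  finite : Module.Finite (WittVector p k) M
  F : M →ₛₗ[wittFrob p k] M
  injective : Function.Injective F

section

variable {p : ℕ} [Fact p.Prime] {k : Type*} [Field k] [CharP k p] [PerfectRing k p]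
variable {M : Type*} [AddCommGroup M] [Module (WittVector p k) M]

/-- The transpose `F^* : M^* → M^*` of a `σ`-linear map `F : M → M`, given by
`F^*(φ) = σ⁻¹ ∘ φ ∘ F`, where `M^* = Hom_{W(k)}(M, W(k))`. -/
def transposeMap (F : M →ₛₗ[wittFrob p k] M) (φ : Module.Dual (WittVector p k) M) :
    Module.Dual (WittVector p k) M where
  toFun m := (WittVector.frobeniusEquiv p k).symm (φ (F m))
  map_add' x y := by simp
  map_smul' r x := by
    rw [LinearMap.map_smulₛₗ, map_smul, smul_eq_mul, map_mul]
    congr 1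
    exact (WittVector.frobeniusEquiv p k).symm_apply_apply r

end

/-- A self-dual `F`-crystal `(M, F_M, F_{M^*}, Ψ, c)` over `k` with underlying module `M`. -/
structure SelfDualFCrystal (p : ℕ) [Fact p.Prime] (k : Type*) [Field k] [CharP k p]
    [PerfectRing k p] (M : Type*) [AddCommGroup M] [Module (WittVector p k) M]
    extends FCrystal p k M where
  /-- The `F`-crystal structure `F_{M^*}` on the dual module. -/
  dual : FCrystal p k (Module.Dual (WittVector p k) M)
  c : WittVector p k
  c_ne_zero : c ≠ 0
  dual_transpose : ∀ φ : Module.Dual (WittVector p k) M, dual.F (transposeMap F φ) = c • φ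
  transpose_dual : ∀ φ : Module.Dual (WittVector p k) M,
    transposeMap F (dual.F φ) = (WittVector.frobeniusEquiv p k).symm c • φ
  /-- The isomorphism of `F`-crystals `(M, F_M) ≃ (M^*, F_{M^*})`. -/
  Ψ : M ≃ₗ[WittVector p k] Module.Dual (WittVector p k) M
  Ψ_comm : ∀ m : M, Ψ (F m) = dual.F (Ψ m)

/-! ### Hodge slopes

Slopes are recorded as weakly increasing lists, with multiplicity. -/

section

variable {p : ℕ} [Fact p.Prime] {k : Type*} [Field k] [CharP k p] [PerfectRing k p]
variable {M : Type*} [AddCommGroup M] [Module (WittVector p k) M]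

/-- `a = [a₁ ≤ ⋯ ≤ aₙ]` is the list of Hodge slopes of `C = (M, F)`: there are two `W(k)`-bases
`v`, `w` of `M` with `F(vᵢ) = p ^ aᵢ wᵢ`. -/
def IsHodgeSlopes (C : FCrystal p k M) (a : List ℕ) : Prop :=
  a.Pairwise (· ≤ ·) ∧
    ∃ v w : Module.Basis (Fin a.length) (WittVector p k) M,
      ∀ i, C.F (v i) = (p : WittVector p k) ^ a.get i • w i

end

/-! ### Extension of scalars to `K' = Frac W(k')`, with `k'` an algebraic closure of `k` -/

/-- The field `K' = Frac W(k')`, where `k'` is an algebraic closure of `k`. -/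
abbrev KBar (p : ℕ) [Fact p.Prime] (k : Type*) [Field k] [CharP k p] : Type _ :=
  FractionRing (WittVector p (AlgebraicClosure k))

/-- The Frobenius automorphism of `K'`, as a ring homomorphism. -/
abbrev kBarFrob (p : ℕ) [Fact p.Prime] (k : Type*) [Field k] [CharP k p] :
    KBar p k →+* KBar p k :=
  WittVector.FractionRing.frobeniusRingHom p (AlgebraicClosure k)

/-- `W(k')` is a `W(k)`-algebra by functoriality of Witt vectors. -/
instance wittAlgebra (p : ℕ) [Fact p.Prime] (k : Type*) [Field k] :
    Algebra (WittVector p k) (WittVector p (AlgebraicClosure k)) :=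
  (WittVector.map (algebraMap k (AlgebraicClosure k))).toAlgebra

section

variable (p : ℕ) [Fact p.Prime] (k : Type*) [Field k] [CharP k p]

theorem kBarFrob_algebraMap (r : WittVector p k) :
    kBarFrob p k (algebraMap (WittVector p k) (KBar p k) r) =
      algebraMap (WittVector p k) (KBar p k) (wittFrob p k r) := by
  rw [IsScalarTower.algebraMap_apply (WittVector p k) (WittVector p (AlgebraicClosure k)) (KBar p k),
    IsScalarTower.algebraMap_apply (WittVector p k) (WittVector p (AlgebraicClosure k)) (KBar p k)]
  have h1 : ∀ x : WittVector p (AlgebraicClosure k),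
      kBarFrob p k (algebraMap _ (KBar p k) x) =
        algebraMap _ (KBar p k) (WittVector.frobenius x) := fun x =>
    IsFractionRing.ringEquivOfRingEquiv_algebraMap
      (WittVector.frobeniusEquiv p (AlgebraicClosure k)) x
  rw [h1]
  congr 1
  exact ((WittVector.frobenius_isPoly p).map (algebraMap k (AlgebraicClosure k)) r).symm

end

section

variable {p : ℕ} [Fact p.Prime] {k : Type*} [Field k] [CharP k p] [PerfectRing k p]
variable {M : Type*} [AddCommGroup M] [Module (WittVector p k) M]

/-- The additive map `σ ⊗ F` on `K' ⊗ M`, with `x ⊗ m ↦ σ(x) ⊗ F(m)`. -/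
def FCrystal.baseChangeAdd (C : FCrystal p k M) :
    (KBar p k ⊗[WittVector p k] M) →+ (KBar p k ⊗[WittVector p k] M) :=
  TensorProduct.liftAddHom
    { toFun := fun x =>
        (TensorProduct.mk (WittVector p k) (KBar p k) M (kBarFrob p k x)).toAddMonoidHom.comp
          C.F.toAddMonoidHom
      map_zero' := by ext; simp
      map_add' := by intro x y; ext; simp }
    (by
      intro r x m
      change kBarFrob p k (r • x) ⊗ₜ[WittVector p k] C.F m =
        kBarFrob p k x ⊗ₜ[WittVector p k] C.F (r • m)
      rw [LinearMap.map_smulₛₗ, Algebra.smul_def, map_mul, kBarFrob_algebraMap,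
        ← Algebra.smul_def, TensorProduct.smul_tmul])

theorem FCrystal.baseChangeAdd_tmul (C : FCrystal p k M) (x : KBar p k) (m : M) :
    C.baseChangeAdd (x ⊗ₜ[WittVector p k] m) = kBarFrob p k x ⊗ₜ[WittVector p k] C.F m :=
  rfl

/-- The `σ`-linear endomorphism of `K' ⊗ M` induced by the Frobenius of the `F`-crystal. -/
def FCrystal.baseChange (C : FCrystal p k M) :
    (KBar p k ⊗[WittVector p k] M) →ₛₗ[kBarFrob p k] (KBar p k ⊗[WittVector p k] M) where
  toFun := C.baseChangeAdd
  map_add' := C.baseChangeAdd.map_add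
  map_smul' y z := by
    induction z with
    | zero => simp
    | add a b ha hb => rw [smul_add, map_add, ha, hb, map_add, smul_add]
    | tmul x m =>
      rw [TensorProduct.smul_tmul', FCrystal.baseChangeAdd_tmul, FCrystal.baseChangeAdd_tmul,
        TensorProduct.smul_tmul', smul_eq_mul, map_mul, smul_eq_mul]

end

/-! ### Simple isocrystals and Newton slopes -/

section

variable (p : ℕ) [Fact p.Prime] (k : Type*) [Field k] [CharP k p]

/-- The polynomial `T ^ r - p ^ s` over `K'`. -/
def simplePoly (r : ℕ) (s : ℤ) : (KBar p k)[X] :=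
  Polynomial.X ^ r - Polynomial.C ((p : KBar p k) ^ s)

theorem simplePoly_map (r : ℕ) (s : ℤ) :
    (simplePoly p k r s).map (kBarFrob p k) = simplePoly p k r s := by
  simp [simplePoly, map_zpow₀]

/-- The isocrystal `V_{s/r}` over `k'`: the `K'`-vector space
`K'[T]/(T ^ r - p ^ s) = ℚ_p[T]/(T ^ r - p ^ s) ⊗ K'`. For `s < 0` this is the dual of
`V_{-s/r}`. -/
abbrev SimpleIso (r : ℕ) (s : ℤ) : Type _ :=
  AdjoinRoot (simplePoly p k r s)

/-- The `σ`-linear Frobenius `(multiplication by T) ⊗ σ` of `V_{s/r}`. -/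
def simpleFrob (r : ℕ) (s : ℤ) :
    SimpleIso p k r s →ₛₗ[kBarFrob p k] SimpleIso p k r s where
  toFun x := AdjoinRoot.root (simplePoly p k r s) *
    AdjoinRoot.map (kBarFrob p k) (simplePoly p k r s) (simplePoly p k r s)
      (simplePoly_map p k r s).symm.dvd x
  map_add' x y := by rw [map_add, mul_add]
  map_smul' y x := by
    rw [Algebra.smul_def, map_mul, Algebra.smul_def, AdjoinRoot.algebraMap_eq, AdjoinRoot.map_of]
    ring

end

section

variable {p : ℕ} [Fact p.Prime] {k : Type*} [Field k] [CharP k p] [PerfectRing k p]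
variable {M : Type*} [AddCommGroup M] [Module (WittVector p k) M]

/-- `l = [λ₁ ≤ ⋯ ≤ λₙ]` is the list of Newton slopes of `C = (M, F)`: the isocrystal
`(K' ⊗ M, σ ⊗ F)` is isomorphic to a finite direct sum of isocrystals `V_{sᵢ/rᵢ}`, with `sᵢ`, `rᵢ`
coprime and `rᵢ > 0`, and `l` lists the `sᵢ/rᵢ` in increasing order, each repeated `rᵢ` times. -/
def IsNewtonSlopes (C : FCrystal p k M) (l : List ℚ) : Prop :=
  l.Pairwise (· ≤ ·) ∧
    ∃ (m : ℕ) (r : Fin m → ℕ) (s : Fin m → ℤ),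
      (∀ i, 0 < r i ∧ IsCoprime (s i) (r i : ℤ)) ∧
      (∃ e : (KBar p k ⊗[WittVector p k] M) ≃ₗ[KBar p k] ((i : Fin m) → SimpleIso p k (r i) (s i)),
        ∀ z i, e (C.baseChange z) i = simpleFrob p k (r i) (s i) (e z i)) ∧
      (l : Multiset ℚ) = ∑ i, Multiset.replicate (r i) ((s i : ℚ) / (r i : ℚ))

end

/-! ### Polygons -/

/-- The ordinate at the integer abscissa `i` of the polygon with initial point `(0, 0)` and slopes
`l₁, l₂, …`, that is `l₁ + ⋯ + lᵢ`. -/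
def polygon (l : List ℚ) (i : ℕ) : ℚ := (l.take i).sum

/-- `(A, B)` is a break point of the polygon with slopes `l`: it lies on the polygon, it is not an
end point, and the slopes to the left and to the right of it are different. -/
def IsBreakPoint (l : List ℚ) (A : ℕ) (B : ℤ) : Prop :=
  0 < A ∧ A < l.length ∧ polygon l A = B ∧
    polygon l A - polygon l (A - 1) ≠ polygon l (A + 1) - polygon l A

/-- The Hodge polygon at the integer abscissa `i`. -/
def hodgePolygon (a : List ℕ) (i : ℕ) : ℚ := polygon (a.map (fun x => (x : ℚ))) i

/-- The first `A` and the last `A` entries of a list of length at least `2 * A`. -/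
def outerPart {α : Type*} (A : ℕ) (l : List α) : List α := l.take A ++ l.drop (l.length - A)

/-- The entries of a list of length at least `2 * A` without the first `A` and the last `A`. -/
def middlePart {α : Type*} (A : ℕ) (l : List α) : List α := (l.take (l.length - A)).drop A

/-! ### Decompositions -/

section

variable {p : ℕ} [Fact p.Prime] {k : Type*} [Field k] [CharP k p] [PerfectRing k p]
variable {M : Type*} [AddCommGroup M] [Module (WittVector p k) M]

/-- The Frobenius of the `F`-crystal `E` on the submodule `S` of `M` is the restriction of the
Frobenius of `C` (so that in particular `S` is `F`-stable). -/
def IsSubcrystal (C : FCrystal p k M) {S : Submodule (WittVector p k) M}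
    (E : FCrystal p k S) : Prop :=
  ∀ x : S, ((E.F x : S) : M) = C.F (x : M)

/-- `(M, F) = (S₁ ⊕ S₂, F₁ ⊕ F₂)` is a direct sum decomposition into the `F`-crystals underlying
two self-dual `F`-crystals `E₁`, `E₂` with the same constant `c` as `D`, where `S₁`, `S₂` have
ranks `2A` and `n - 2A`, the Hodge and Newton slopes of `E₁` are the first `A` and the last `A`
entries of `a` and `l`, and those of `E₂` are the remaining ones. -/
structure IsSelfDualDecomposition (D : SelfDualFCrystal p k M) (a : List ℕ) (l : List ℚ) (n A : ℕ)
    {S₁ S₂ : Submodule (WittVector p k) M}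
    (E₁ : SelfDualFCrystal p k S₁) (E₂ : SelfDualFCrystal p k S₂) : Prop where
  isCompl : IsCompl S₁ S₂
  sub₁ : IsSubcrystal D.toFCrystal E₁.toFCrystal
  sub₂ : IsSubcrystal D.toFCrystal E₂.toFCrystal
  c₁ : E₁.c = D.c
  c₂ : E₂.c = D.c
  rank₁ : Module.finrank (WittVector p k) S₁ = 2 * A
  rank₂ : Module.finrank (WittVector p k) S₂ = n - 2 * A
  hodge₁ : IsHodgeSlopes E₁.toFCrystal (outerPart A a)
  newton₁ : IsNewtonSlopes E₁.toFCrystal (outerPart A l)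
  hodge₂ : IsHodgeSlopes E₂.toFCrystal (middlePart A a)
  newton₂ : IsNewtonSlopes E₂.toFCrystal (middlePart A l)

/-- `Ψ = Ψ₁ ⊕ Ψ₂`: the forms `Ψ₁`, `Ψ₂` are the restrictions of `Ψ`, and `S₁`, `S₂` are orthogonal
to each other on both sides. -/
structure IsOrthogonalSum (D : SelfDualFCrystal p k M) {S₁ S₂ : Submodule (WittVector p k) M}
    (E₁ : SelfDualFCrystal p k S₁) (E₂ : SelfDualFCrystal p k S₂) : Prop where
  form₁ : ∀ x y : S₁, E₁.Ψ x y = D.Ψ (x : M) (y : M)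
  form₂ : ∀ x y : S₂, E₂.Ψ x y = D.Ψ (x : M) (y : M)
  orth₁₂ : ∀ x ∈ S₁, ∀ y ∈ S₂, D.Ψ x y = 0
  orth₂₁ : ∀ x ∈ S₂, ∀ y ∈ S₁, D.Ψ x y = 0

end

end NewtonHodge

end

open scoped TensorProduct Polynomial

noncomputable section

set_option linter.unusedSectionVars false

namespace NewtonHodge

/-! Over `K'` the isocrystal splits canonically into slope parts. The task is to show that the
projection to the slopes at most `l₀ = λ_A` preserves the lattice `M`; duality then yields
everything else.

Integrality. The projection commutes with the Galois group of `k'/k`, so a multiple `p ^ c` of it is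
defined over `W(k)` (`exists_integral_multiple`), and the vectors of `M` in the small-slope part
form a direct summand `S`. The Hodge and Newton polygons of `S` have the same end point
(`sum_eq_sum_slopes`), and by hypothesis this point lies on the Hodge polygon of `M`. Hence every
maximal minor of `F` with values in `S` is divisible by the determinant of `F` on `S`, and Cramer's
rule shows that for each retraction `ρ : M → S` the map `F⁻¹ ρ F` is again an integral retraction
(`exists_retraction_step`). The maps `F⁻ʲ ρ Fʲ` approach the slope projection `p`-adically, because
the error is contracted by the gap between the slopes at most `l₀` and the others; so the projection
is integral (`exists_integral_proj`).

Duality. Since `Ψ(Fx, Fy) = c σ(Ψ(x, y))`, the form pairs slope `λ` only with slope `v(c) - λ`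
(`slope_add_slope`). Thus the adjoint `h` of the integral projection `g` is the projection to the
reflected slopes, and it is integral because `Ψ` is perfect over `W(k)`. The assumption `A < n/2`
makes the two slope ranges disjoint, so `g + h` and `(1 - g)(1 - h)` are complementary self-adjoint
idempotents commuting with `F`; their images are the two summands. A stable submodule with
prescribed slopes lies in the corresponding slope part, which gives uniqueness.

Hodge slopes. Those of the image of `g` are `A` of the `aᵢ` with the least possible sum, so they are
the first `A`; those of the image of `h` follow by duality, and the middle ones by cancellation in
the direct sum. -/

section

/-! ### The `p`-adic valuation of `K'`. -/

section Field

variable {p : ℕ} [Fact p.Prime] {k : Type*} [Field k] [CharP k p]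

/-- The ring `W(k')` of Witt vectors of an algebraic closure of `k`. -/
abbrev WBar (p : ℕ) (k : Type*) [Field k] : Type _ := WittVector p (AlgebraicClosure k)

theorem kBar_p_ne_zero : (p : KBar p k) ≠ 0 := by
  rw [← map_natCast (algebraMap (WBar p k) (KBar p k))]
  exact (map_ne_zero_iff _ (IsFractionRing.injective (WBar p k) (KBar p k))).mpr
    (WittVector.p_nonzero p (AlgebraicClosure k))

theorem exists_zpow_mul_unit {x : KBar p k} (hx : x ≠ 0) :
    ∃ (m : ℤ) (u : (WBar p k)ˣ), x = (p : KBar p k) ^ m * algebraMap (WBar p k) (KBar p k) u := by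
  obtain ⟨a, b, hb, rfl⟩ := IsFractionRing.div_surjective (A := WBar p k) x
  have hb0 : b ≠ 0 := nonZeroDivisors.ne_zero hb
  have ha0 : a ≠ 0 := by rintro rfl; simp at hx
  obtain ⟨m, u, rfl⟩ := WittVector.exists_eq_pow_p_mul' a ha0
  obtain ⟨m', u', rfl⟩ := WittVector.exists_eq_pow_p_mul' b hb0
  refine ⟨m - m', u * u'⁻¹, ?_⟩
  have hp := kBar_p_ne_zero (p := p) (k := k)
  have hu' : algebraMap (WBar p k) (KBar p k) u' ≠ 0 :=
    (u'.isUnit.map (algebraMap (WBar p k) (KBar p k))).ne_zero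
  have : algebraMap (WBar p k) (KBar p k) u' * algebraMap (WBar p k) (KBar p k) ↑(u'⁻¹) = 1 := by
    rw [← map_mul]; simp
  rw [zpow_sub₀ hp]
  simp only [map_mul, map_pow, map_natCast, zpow_natCast, Units.val_mul]
  field_simp
  linear_combination -this

theorem not_p_dvd_unit (u : (WBar p k)ˣ) : ¬ (p : WBar p k) ∣ u := fun h =>
  (WittVector.irreducible p).not_isUnit (isUnit_of_dvd_unit h u.isUnit)

theorem zpow_mul_unit_unique {m m' : ℤ} {u u' : (WBar p k)ˣ}
    (h : (p : KBar p k) ^ m * algebraMap (WBar p k) (KBar p k) u =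
      (p : KBar p k) ^ m' * algebraMap (WBar p k) (KBar p k) u') : m = m' := by
  have hp := kBar_p_ne_zero (p := p) (k := k)
  have key : ∀ {m m' : ℤ} {u u' : (WBar p k)ˣ},
      (p : KBar p k) ^ m * algebraMap (WBar p k) (KBar p k) u =
      (p : KBar p k) ^ m' * algebraMap (WBar p k) (KBar p k) u' → ¬ m < m' := by
    intro m m' u u' h hlt
    obtain ⟨t, ht⟩ := Int.eq_ofNat_of_zero_le (sub_nonneg.mpr (Int.add_one_le_iff.mpr hlt))
    have h2 : algebraMap (WBar p k) (KBar p k) u =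
        algebraMap (WBar p k) (KBar p k) ((p : WBar p k) * ((p : WBar p k) ^ t * u')) := by
      have h3 : m' = m + 1 + t := by omega
      rw [h3, zpow_add₀ hp, zpow_add₀ hp, zpow_one, zpow_natCast, mul_assoc, mul_assoc] at h
      simpa using mul_left_cancel₀ (zpow_ne_zero m hp) h
    exact not_p_dvd_unit u ⟨_, IsFractionRing.injective (WBar p k) (KBar p k) h2⟩
  rcases lt_trichotomy m m' with h1 | h1 | h1
  · exact absurd h1 (key h)
  · exact h1
  · exact absurd h1 (key h.symm)

/-- The `p`-adic valuation of `K'`, with the value `0` at `0`. -/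
def valK (x : KBar p k) : ℤ :=
  open Classical in if hx : x = 0 then 0 else (exists_zpow_mul_unit hx).choose

theorem valK_spec {x : KBar p k} (hx : x ≠ 0) :
    ∃ u : (WBar p k)ˣ, x = (p : KBar p k) ^ valK x * algebraMap (WBar p k) (KBar p k) u := by
  rw [valK, dif_neg hx]
  exact (exists_zpow_mul_unit hx).choose_spec

theorem zpow_mul_unit_ne_zero (m : ℤ) (u : (WBar p k)ˣ) :
    (p : KBar p k) ^ m * algebraMap (WBar p k) (KBar p k) u ≠ 0 :=
  mul_ne_zero (zpow_ne_zero m kBar_p_ne_zero)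
    (u.isUnit.map (algebraMap (WBar p k) (KBar p k))).ne_zero

theorem valK_zpow_mul_unit (m : ℤ) (u : (WBar p k)ˣ) :
    valK ((p : KBar p k) ^ m * algebraMap (WBar p k) (KBar p k) u) = m := by
  obtain ⟨u', hu'⟩ := valK_spec (zpow_mul_unit_ne_zero m u)
  exact (zpow_mul_unit_unique hu').symm

theorem valK_zpow (m : ℤ) : valK ((p : KBar p k) ^ m) = m := by
  simpa using valK_zpow_mul_unit (p := p) (k := k) m 1

theorem valK_mul {x y : KBar p k} (hx : x ≠ 0) (hy : y ≠ 0) : valK (x * y) = valK x + valK y := by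
  obtain ⟨u, hu⟩ := valK_spec hx
  obtain ⟨v, hv⟩ := valK_spec hy
  have : x * y = (p : KBar p k) ^ (valK x + valK y) *
      algebraMap (WBar p k) (KBar p k) ((u * v : (WBar p k)ˣ) : WBar p k) := by
    rw [zpow_add₀ kBar_p_ne_zero, Units.val_mul, map_mul]
    conv_lhs => rw [hu, hv]
    ring
  rw [this, valK_zpow_mul_unit]

theorem kBarFrob_algebraMap_bar (x : WBar p k) :
    kBarFrob p k (algebraMap (WBar p k) (KBar p k) x) =
      algebraMap (WBar p k) (KBar p k) (WittVector.frobenius x) :=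
  IsFractionRing.ringEquivOfRingEquiv_algebraMap
    (WittVector.frobeniusEquiv p (AlgebraicClosure k)) x

theorem kBarFrob_zpow (m : ℤ) : kBarFrob p k ((p : KBar p k) ^ m) = (p : KBar p k) ^ m := by
  rw [map_zpow₀, map_natCast]

theorem kBarFrob_zpow_mul_unit (m : ℤ) (u : (WBar p k)ˣ) :
    kBarFrob p k ((p : KBar p k) ^ m * algebraMap (WBar p k) (KBar p k) u) =
      (p : KBar p k) ^ m * algebraMap (WBar p k) (KBar p k)
        (Units.map (WittVector.frobenius : WBar p k →+* WBar p k).toMonoidHom u : (WBar p k)ˣ) := by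
  rw [map_mul, kBarFrob_zpow, kBarFrob_algebraMap_bar]; rfl

theorem valK_kBarFrob (x : KBar p k) : valK (kBarFrob p k x) = valK x := by
  rcases eq_or_ne x 0 with rfl | hx
  · simp
  obtain ⟨m, u, rfl⟩ := exists_zpow_mul_unit hx
  rw [kBarFrob_zpow_mul_unit, valK_zpow_mul_unit, valK_zpow_mul_unit]

theorem kBarFrob_bijective : Function.Bijective (kBarFrob p k) :=
  (WittVector.FractionRing.frobenius p (AlgebraicClosure k)).bijective

theorem iterate_kBarFrob_zpow (N : ℕ) (m : ℤ) :
    (kBarFrob p k)^[N] ((p : KBar p k) ^ m) = (p : KBar p k) ^ m := by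
  induction N with
  | zero => rfl
  | succ N ih => rw [Function.iterate_succ_apply, kBarFrob_zpow, ih]

theorem valK_iterate_kBarFrob (N : ℕ) (x : KBar p k) : valK ((kBarFrob p k)^[N] x) = valK x := by
  induction N with
  | zero => rfl
  | succ N ih => rw [Function.iterate_succ_apply', valK_kBarFrob, ih]

/-- `x` belongs to `p ^ m W(k')`. -/
def IsInt (m : ℤ) (x : KBar p k) : Prop :=
  ∃ w : WBar p k, x = (p : KBar p k) ^ m * algebraMap (WBar p k) (KBar p k) w

theorem IsInt.zero (m : ℤ) : IsInt m (0 : KBar p k) := ⟨0, by simp⟩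

theorem IsInt.add {m : ℤ} {x y : KBar p k} (hx : IsInt m x) (hy : IsInt m y) :
    IsInt m (x + y) := by
  obtain ⟨u, rfl⟩ := hx
  obtain ⟨v, rfl⟩ := hy
  exact ⟨u + v, by rw [map_add, mul_add]⟩

theorem IsInt.sum {m : ℤ} {ι : Type*} {s : Finset ι} {f : ι → KBar p k}
    (h : ∀ i ∈ s, IsInt m (f i)) : IsInt m (∑ i ∈ s, f i) :=
  Finset.sum_induction f (IsInt m) (fun _ _ => IsInt.add) (IsInt.zero m) h

theorem IsInt.mul {m m' : ℤ} {x y : KBar p k} (hx : IsInt m x) (hy : IsInt m' y) :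
    IsInt (m + m') (x * y) := by
  obtain ⟨u, rfl⟩ := hx
  obtain ⟨v, rfl⟩ := hy
  exact ⟨u * v, by rw [map_mul, zpow_add₀ kBar_p_ne_zero]; ring⟩

theorem IsInt.mono {m m' : ℤ} {x : KBar p k} (h : IsInt m x) (hm : m' ≤ m) : IsInt m' x := by
  obtain ⟨u, rfl⟩ := h
  obtain ⟨t, ht⟩ := Int.eq_ofNat_of_zero_le (sub_nonneg.mpr hm)
  refine ⟨(p : WBar p k) ^ t * u, ?_⟩
  rw [show m = m' + t by omega, zpow_add₀ kBar_p_ne_zero, zpow_natCast, map_mul, map_pow,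
    map_natCast, mul_assoc]

theorem isInt_zpow (m : ℤ) : IsInt m ((p : KBar p k) ^ m) := ⟨1, by simp⟩

theorem isInt_algebraMap_bar (w : WBar p k) : IsInt 0 (algebraMap (WBar p k) (KBar p k) w) :=
  ⟨w, by simp⟩

theorem isInt_algebraMap (w : WittVector p k) :
    IsInt 0 (algebraMap (WittVector p k) (KBar p k) w) := by
  rw [IsScalarTower.algebraMap_apply (WittVector p k) (WBar p k) (KBar p k)]
  exact isInt_algebraMap_bar _

theorem isInt_valK (x : KBar p k) : IsInt (valK x) x := by
  rcases eq_or_ne x 0 with rfl | hx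
  · exact IsInt.zero _
  · obtain ⟨u, hu⟩ := valK_spec hx
    exact ⟨u, hu⟩

theorem IsInt.of_le_valK {m : ℤ} {x : KBar p k} (h : m ≤ valK x) : IsInt m x :=
  (isInt_valK x).mono h

theorem IsInt.le_valK {m : ℤ} {x : KBar p k} (h : IsInt m x) (hx : x ≠ 0) : m ≤ valK x := by
  obtain ⟨w, rfl⟩ := h
  have hw : w ≠ 0 := by rintro rfl; simp at hx
  obtain ⟨t, u, rfl⟩ := WittVector.exists_eq_pow_p_mul' w hw
  have : (p : KBar p k) ^ m * algebraMap (WBar p k) (KBar p k) ((p : WBar p k) ^ t * u) =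
      (p : KBar p k) ^ (m + t) * algebraMap (WBar p k) (KBar p k) u := by
    rw [zpow_add₀ kBar_p_ne_zero, zpow_natCast, map_mul, map_pow, map_natCast, mul_assoc]
  rw [this, valK_zpow_mul_unit]
  omega

/-- Iterating a semilinear map twists coordinates by powers of `σ`; since `σ` preserves valuations,
the twist can be dropped from integrality estimates. -/
theorem IsInt.iterate_iff {m : ℤ} {x : KBar p k} (N : ℕ) :
    IsInt m ((NewtonHodge.kBarFrob p k)^[N] x) ↔ IsInt m x := by
  rcases eq_or_ne x 0 with rfl | hx
  · rw [iterate_map_zero]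
  · have hx' : (NewtonHodge.kBarFrob p k)^[N] x ≠ 0 := fun h =>
      hx ((kBarFrob_bijective.injective.iterate N) (by rw [h, iterate_map_zero]))
    exact ⟨fun h => .of_le_valK (by simpa [valK_iterate_kBarFrob] using h.le_valK hx'),
      fun h => .of_le_valK (by simpa [valK_iterate_kBarFrob] using h.le_valK hx)⟩

theorem wittAlgebra_apply (w : WittVector p k) : algebraMap (WittVector p k) (WBar p k) w =
    WittVector.map (algebraMap k (AlgebraicClosure k)) w := rfl

theorem algebraMap_kBar_injective : Function.Injective (algebraMap (WittVector p k) (KBar p k)) := by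
  rw [IsScalarTower.algebraMap_eq (WittVector p k) (WBar p k) (KBar p k)]
  exact (IsFractionRing.injective (WBar p k) (KBar p k)).comp
    (WittVector.map_injective _ (algebraMap k (AlgebraicClosure k)).injective)

section Perfect

variable [PerfectRing k p]

theorem valK_algebraMap_pow_mul_unit (m : ℕ) (u : (WittVector p k)ˣ) :
    valK (algebraMap (WittVector p k) (KBar p k) ((p : WittVector p k) ^ m * u)) = m := by
  have := valK_zpow_mul_unit (p := p) (k := k) m
    (Units.map (algebraMap (WittVector p k) (WBar p k)).toMonoidHom u)
  rw [← this]
  congr 1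
  rw [map_mul, map_pow, map_natCast, zpow_natCast]
  rw [IsScalarTower.algebraMap_apply (WittVector p k) (WBar p k) (KBar p k)]
  rfl

theorem valK_algebraMap_unit {u : WittVector p k} (hu : IsUnit u) :
    valK (algebraMap (WittVector p k) (KBar p k) u) = 0 := by
  obtain ⟨u, rfl⟩ := hu
  simpa using valK_algebraMap_pow_mul_unit (p := p) 0 u

/-- The extension `W(k) → W(k')` is unramified, so estimates made over `K'` give divisibility over
`W(k)`. -/
theorem isInt_algebraMap_iff (m : ℕ) (w : WittVector p k) :
    IsInt m (algebraMap (WittVector p k) (KBar p k) w) ↔ (p : WittVector p k) ^ m ∣ w := by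
  rcases eq_or_ne w 0 with rfl | hw
  · simp [IsInt.zero]
  constructor
  · intro h
    have h2 := h.le_valK (by simpa using (map_ne_zero_iff _ algebraMap_kBar_injective).mpr hw)
    obtain ⟨t, u, rfl⟩ := WittVector.exists_eq_pow_p_mul' w hw
    rw [valK_algebraMap_pow_mul_unit] at h2
    exact Dvd.dvd.mul_right (pow_dvd_pow _ (by exact_mod_cast h2)) _
  · rintro ⟨w, rfl⟩
    rw [map_mul, map_pow, map_natCast, ← zpow_natCast]
    simpa using (isInt_zpow (p := p) (k := k) m).mul (isInt_algebraMap w)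

end Perfect

/-! ### The action of the Galois group -/

/-- The automorphism of `W(k')` induced by an automorphism of `k'`. -/
def galWBar (γ : AlgebraicClosure k ≃ₐ[k] AlgebraicClosure k) : WBar p k →+* WBar p k :=
  WittVector.map (γ : AlgebraicClosure k →+* AlgebraicClosure k)

theorem galWBar_injective (γ : AlgebraicClosure k ≃ₐ[k] AlgebraicClosure k) :
    Function.Injective (galWBar (p := p) γ) :=
  WittVector.map_injective _ γ.injective

theorem galWBar_algebraMap (γ : AlgebraicClosure k ≃ₐ[k] AlgebraicClosure k)
    (w : WittVector p k) :
    galWBar γ (algebraMap (WittVector p k) (WBar p k) w) = algebraMap _ _ w := by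
  ext i
  simp [galWBar, wittAlgebra_apply, WittVector.map_coeff]

theorem galWBar_frobenius (γ : AlgebraicClosure k ≃ₐ[k] AlgebraicClosure k) (w : WBar p k) :
    galWBar γ (WittVector.frobenius w) = WittVector.frobenius (galWBar γ w) :=
  (WittVector.frobenius_isPoly p).map _ w

/-- The automorphism of `K'` induced by an automorphism of `k'`. -/
def galKBarHom (γ : AlgebraicClosure k ≃ₐ[k] AlgebraicClosure k) : KBar p k →+* KBar p k :=
  IsFractionRing.map (galWBar_injective γ)

theorem galKBarHom_algebraMap (γ : AlgebraicClosure k ≃ₐ[k] AlgebraicClosure k) (w : WBar p k) :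
    galKBarHom γ (algebraMap (WBar p k) (KBar p k) w) = algebraMap _ _ (galWBar γ w) :=
  IsLocalization.map_eq (S := KBar p k) (nonZeroDivisors_le_comap_nonZeroDivisors_of_injective
    (galWBar γ) (galWBar_injective γ)) w

/-- The automorphism of the `W(k)`-algebra `K'` induced by an automorphism of `k'`. -/
def galKBar (γ : AlgebraicClosure k ≃ₐ[k] AlgebraicClosure k) :
    KBar p k →ₐ[WittVector p k] KBar p k :=
  { galKBarHom γ with
    commutes' := fun w => by
      change galKBarHom γ (algebraMap (WittVector p k) (KBar p k) w) = _
      rw [IsScalarTower.algebraMap_apply (WittVector p k) (WBar p k) (KBar p k),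
        galKBarHom_algebraMap, galWBar_algebraMap] }

theorem galKBar_algebraMap (γ : AlgebraicClosure k ≃ₐ[k] AlgebraicClosure k) (w : WBar p k) :
    galKBar γ (algebraMap (WBar p k) (KBar p k) w) = algebraMap _ _ (galWBar γ w) :=
  galKBarHom_algebraMap γ w

theorem galKBar_kBarFrob (γ : AlgebraicClosure k ≃ₐ[k] AlgebraicClosure k) (x : KBar p k) :
    galKBar γ (kBarFrob p k x) = kBarFrob p k (galKBar γ x) := by
  obtain ⟨a, b, hb, rfl⟩ := IsFractionRing.div_surjective (A := WBar p k) x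
  simp only [map_div₀, kBarFrob_algebraMap_bar, galKBar_algebraMap, galWBar_frobenius]

/-- Galois acts coefficientwise on Witt vectors, so each Witt coefficient of `p ^ C x` is fixed; as
`k` is perfect, `k'/k` is Galois and the coefficients lie in `k`. -/
theorem exists_algebraMap_of_galKBar_fixed [PerfectRing k p] {x : KBar p k}
    (hx : ∀ γ : AlgebraicClosure k ≃ₐ[k] AlgebraicClosure k, galKBar γ x = x) {C : ℕ}
    (hC : IsInt (-C) x) :
    ∃ w : WittVector p k, algebraMap (WittVector p k) (KBar p k) w = (p : KBar p k) ^ C * x := by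
  obtain ⟨y, rfl⟩ := hC
  have hp := kBar_p_ne_zero (p := p) (k := k)
  have hy : ∀ γ : AlgebraicClosure k ≃ₐ[k] AlgebraicClosure k, galWBar γ y = y := by
    intro γ
    apply IsFractionRing.injective (WBar p k) (KBar p k)
    have := hx γ
    rw [map_mul, map_zpow₀, map_natCast, galKBar_algebraMap] at this
    exact mul_left_cancel₀ (zpow_ne_zero _ hp) this
  have : PerfectField k := PerfectRing.toPerfectField k p
  have hcoeff : ∀ i, ∃ c : k, algebraMap k (AlgebraicClosure k) c = y.coeff i := by
    intro i
    have := (InfiniteGalois.mem_bot_iff_fixed (k := k) (K := AlgebraicClosure k) (y.coeff i)).mpr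
      (fun γ => by
        have := congrArg (fun z => WittVector.coeff z i) (hy γ)
        simpa [galWBar, WittVector.map_coeff] using this)
    exact IntermediateField.mem_bot.mp this
  choose c hc using hcoeff
  refine ⟨WittVector.mk p c, ?_⟩
  rw [IsScalarTower.algebraMap_apply (WittVector p k) (WBar p k) (KBar p k),
    zpow_neg, zpow_natCast, mul_inv_cancel_left₀ (pow_ne_zero _ hp)]
  congr 1
  ext i
  rw [wittAlgebra_apply, WittVector.map_coeff, WittVector.coeff_mk, hc]

end Field

end

/-! ### Eigenvectors of iterates of Frobenius and slope projections over `K'`. -/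

section

section Semilinear

variable {R : Type*} [CommRing R] {σ : R →+* R} {V : Type*} [AddCommGroup V] [Module R V]

theorem iterate_semilinear_smul (Φ : V →ₛₗ[σ] V) (j : ℕ) (c : R) (x : V) :
    Φ^[j] (c • x) = (σ^[j] c) • Φ^[j] x := by
  induction j with
  | zero => rfl
  | succ j ih => rw [Function.iterate_succ_apply', ih, LinearMap.map_smulₛₗ,
      ← Function.iterate_succ_apply' σ, ← Function.iterate_succ_apply' Φ]

theorem iterate_semilinear_sum (Φ : V →ₛₗ[σ] V) (j : ℕ) {ι : Type*} (s : Finset ι) (f : ι → V) :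
    Φ^[j] (∑ i ∈ s, f i) = ∑ i ∈ s, Φ^[j] (f i) := by
  induction j with
  | zero => rfl
  | succ j ih => simp only [Function.iterate_succ_apply', ih, map_sum]

theorem iterate_semilinear_zero (Φ : V →ₛₗ[σ] V) (j : ℕ) : Φ^[j] 0 = 0 :=
  Function.iterate_fixed (map_zero Φ) j

end Semilinear

section Simple

variable (p : ℕ) [Fact p.Prime] (k : Type*) [Field k] [CharP k p]

theorem simplePoly_monic {r : ℕ} (hr : 0 < r) (s : ℤ) : (simplePoly p k r s).Monic :=
  Polynomial.monic_X_pow_sub_C _ hr.ne'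

theorem simplePoly_natDegree (r : ℕ) (s : ℤ) : (simplePoly p k r s).natDegree = r :=
  Polynomial.natDegree_X_pow_sub_C

theorem simpleIso_root_pow (r : ℕ) (s : ℤ) :
    AdjoinRoot.root (simplePoly p k r s) ^ r =
      AdjoinRoot.of (simplePoly p k r s) ((p : KBar p k) ^ s) := by
  have h := AdjoinRoot.eval₂_root (simplePoly p k r s)
  conv at h => lhs; arg 3; rw [simplePoly]
  rw [Polynomial.eval₂_sub, Polynomial.eval₂_pow, Polynomial.eval₂_X, Polynomial.eval₂_C,
    sub_eq_zero] at h
  exact h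

/-- The basis `1, T, …, T ^ (r - 1)` of `V_{s/r}`. -/
def simpleBasis {r : ℕ} (hr : 0 < r) (s : ℤ) :
    Module.Basis (Fin (simplePoly p k r s).natDegree) (KBar p k) (SimpleIso p k r s) :=
  AdjoinRoot.powerBasisAux' (simplePoly_monic p k hr s)

theorem simpleBasis_apply {r : ℕ} (hr : 0 < r) (s : ℤ) (i) :
    simpleBasis p k hr s i = AdjoinRoot.root (simplePoly p k r s) ^ (i : ℕ) :=
  PowerBasis.basis_eq_pow (AdjoinRoot.powerBasis' (simplePoly_monic p k hr s)) i

theorem simpleFrob_iterate_root_pow (r : ℕ) (s : ℤ) (i j : ℕ) :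
    (simpleFrob p k r s)^[j] (AdjoinRoot.root (simplePoly p k r s) ^ i) =
      AdjoinRoot.root (simplePoly p k r s) ^ (i + j) := by
  induction j with
  | zero => rfl
  | succ j ih =>
    rw [Function.iterate_succ_apply', ih]
    change AdjoinRoot.root (simplePoly p k r s) *
      AdjoinRoot.map (kBarFrob p k) (simplePoly p k r s) (simplePoly p k r s)
        (simplePoly_map p k r s).symm.dvd _ = _
    rw [map_pow, AdjoinRoot.map_root, ← pow_succ', add_assoc]

/-- On powers of `T` Frobenius is the shift `T ^ i ↦ T ^ (i + 1)`, so `r` steps amount to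
multiplication by `T ^ r = p ^ s`. -/
theorem simpleFrob_iterate_basis {r : ℕ} (hr : 0 < r) (s : ℤ) (t : ℕ) (i) :
    (simpleFrob p k r s)^[r * t] (simpleBasis p k hr s i) =
      (p : KBar p k) ^ (s * t) • simpleBasis p k hr s i := by
  rw [simpleBasis_apply, simpleFrob_iterate_root_pow, pow_add, pow_mul, simpleIso_root_pow,
    ← map_pow, ← zpow_natCast, ← zpow_mul, Algebra.smul_def, AdjoinRoot.algebraMap_eq, mul_comm]

end Simple

variable {p : ℕ} [Fact p.Prime] {k : Type*} [Field k] [CharP k p] [PerfectRing k p]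
variable {M : Type*} [AddCommGroup M] [Module (WittVector p k) M]

/-- The isocrystal `K' ⊗ M`. -/
abbrev IsoSpace (p : ℕ) [Fact p.Prime] (k : Type*) [Field k] [CharP k p]
    (M : Type*) [AddCommGroup M] [Module (WittVector p k) M] : Type _ :=
  KBar p k ⊗[WittVector p k] M

/-- A decomposition of the isocrystal `K' ⊗ M` into simple isocrystals. -/
structure SlopeDecomposition (C : FCrystal p k M) where
  m : ℕ
  r : Fin m → ℕ
  s : Fin m → ℤ
  pos : ∀ i, 0 < r i
  coprime : ∀ i, IsCoprime (s i) (r i : ℤ)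
  e : IsoSpace p k M ≃ₗ[KBar p k] ((i : Fin m) → SimpleIso p k (r i) (s i))
  comm : ∀ z i, e (C.baseChange z) i = simpleFrob p k (r i) (s i) (e z i)

namespace SlopeDecomposition

variable {C : FCrystal p k M} (d : SlopeDecomposition C)

def slope (i : Fin d.m) : ℚ := (d.s i : ℚ) / (d.r i : ℚ)

def slopes : Multiset ℚ := ∑ i, Multiset.replicate (d.r i) (d.slope i)

/-- The index type of the basis of `K' ⊗ M` given by the powers of `T`. -/
abbrev Idx : Type := Σ i : Fin d.m, Fin (simplePoly p k (d.r i) (d.s i)).natDegree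

def piBasis : Module.Basis d.Idx (KBar p k) ((i : Fin d.m) → SimpleIso p k (d.r i) (d.s i)) :=
  Pi.basis fun i => simpleBasis p k (d.pos i) (d.s i)

def basis : Module.Basis d.Idx (KBar p k) (IsoSpace p k M) := d.piBasis.map d.e.symm

theorem e_basis (b : d.Idx) :
    d.e (d.basis b) = Pi.single b.1 (simpleBasis p k (d.pos b.1) (d.s b.1) b.2) := by
  simp [basis, piBasis, Pi.basis_apply]

/-- A common period of the simple isocrystals. -/
def period : ℕ := ∏ i, d.r i

theorem period_pos : 0 < d.period := Finset.prod_pos fun i _ => d.pos i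

theorem r_dvd_period (i : Fin d.m) : d.r i ∣ d.period := Finset.dvd_prod_of_mem _ (Finset.mem_univ i)

/-- The basis vectors satisfy `F ^ period = p ^ expo`. -/
def expo (b : d.Idx) : ℤ := d.s b.1 * (d.period / d.r b.1 : ℕ)

theorem expo_div_period (b : d.Idx) : (d.expo b : ℚ) / d.period = d.slope b.1 := by
  obtain ⟨t, ht⟩ := d.r_dvd_period b.1
  have hr := d.pos b.1
  have h0 := d.period_pos
  have hr' : (d.r b.1 : ℚ) ≠ 0 := by exact_mod_cast hr.ne'
  have ht' : (t : ℚ) ≠ 0 := by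
    rintro h
    rw [Nat.cast_eq_zero] at h
    simp [h] at ht
    omega
  rw [expo, slope, ht, Nat.mul_div_cancel_left _ hr]
  push_cast
  field_simp

theorem expo_eq (b : d.Idx) : (d.expo b : ℚ) = d.slope b.1 * d.period := by
  rw [← expo_div_period, div_mul_cancel₀]
  exact_mod_cast d.period_pos.ne'

theorem e_iterate (j : ℕ) (z : IsoSpace p k M) (i : Fin d.m) :
    d.e (C.baseChange^[j] z) i = (simpleFrob p k (d.r i) (d.s i))^[j] (d.e z i) := by
  induction j with
  | zero => rfl
  | succ j ih => rw [Function.iterate_succ_apply', Function.iterate_succ_apply', d.comm, ih]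

theorem iterate_basis (b : d.Idx) :
    C.baseChange^[d.period] (d.basis b) = (p : KBar p k) ^ d.expo b • d.basis b := by
  apply d.e.injective
  ext1 i
  rw [e_iterate, map_smul, e_basis, Pi.smul_apply]
  by_cases h : i = b.1
  · subst h
    obtain ⟨t, ht⟩ := d.r_dvd_period b.1
    rw [Pi.single_eq_same, expo, ht, Nat.mul_div_cancel_left _ (d.pos b.1),
      simpleFrob_iterate_basis]
  · rw [Pi.single_eq_of_ne h, iterate_semilinear_zero, smul_zero]

theorem iterate_basis_mul (j : ℕ) (b : d.Idx) :
    C.baseChange^[d.period * j] (d.basis b) = (p : KBar p k) ^ (j * d.expo b) • d.basis b := by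
  induction j with
  | zero => simp
  | succ j ih =>
    rw [Nat.mul_succ, Function.iterate_add_apply, iterate_basis, iterate_semilinear_smul, ih,
      iterate_kBarFrob_zpow, smul_smul, ← zpow_add₀ kBar_p_ne_zero]
    congr 2
    push_cast
    ring

theorem repr_iterate (j : ℕ) (x : IsoSpace p k M) (b : d.Idx) :
    d.basis.repr (C.baseChange^[d.period * j] x) b =
      (kBarFrob p k)^[d.period * j] (d.basis.repr x b) * (p : KBar p k) ^ (j * d.expo b) := by
  conv_lhs => rw [← d.basis.sum_repr x]
  rw [iterate_semilinear_sum]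
  simp only [iterate_semilinear_smul, iterate_basis_mul, smul_smul]
  rw [d.basis.repr_sum_self]

/-- Computing the `b`-coordinate of `F ^ (t * period) x` in two ways and comparing valuations gives
`period * m = t * expo b`. This recognizes the slope of an eigenvector from its equation alone, as
needed for Galois conjugates and for vectors from subcrystals. -/
theorem slope_eq_of_iterate {t : ℕ} (ht : 0 < t) {m : ℤ} {x : IsoSpace p k M}
    (hx : C.baseChange^[t] x = (p : KBar p k) ^ m • x) {b : d.Idx} (hb : d.basis.repr x b ≠ 0) :
    d.slope b.1 = m / t := by
  have hit : ∀ j : ℕ, C.baseChange^[t * j] x = (p : KBar p k) ^ (j * m) • x := by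
    intro j
    induction j with
    | zero => simp
    | succ j ih =>
      rw [Nat.mul_succ, Function.iterate_add_apply, hx, iterate_semilinear_smul, ih,
        iterate_kBarFrob_zpow, smul_smul, ← zpow_add₀ kBar_p_ne_zero]
      congr 2
      push_cast
      ring
  have h1 := d.repr_iterate t x b
  rw [mul_comm d.period t, hit, map_smul, Finsupp.smul_apply, smul_eq_mul] at h1
  have h2 : (kBarFrob p k)^[t * d.period] (d.basis.repr x b) ≠ 0 := fun h =>
    hb ((kBarFrob_bijective.injective.iterate _) (by rw [h, iterate_map_zero]))
  have h3 := congrArg valK h1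
  rw [valK_mul (zpow_ne_zero _ kBar_p_ne_zero) hb, valK_mul h2 (zpow_ne_zero _ kBar_p_ne_zero),
    valK_iterate_kBarFrob, valK_zpow, valK_zpow] at h3
  have h4 : (d.period : ℚ) * m = t * d.expo b := by
    have : (d.period : ℤ) * m = t * d.expo b := by linarith
    exact_mod_cast this
  have h5 : (d.period : ℚ) ≠ 0 := by exact_mod_cast d.period_pos.ne'
  have h6 : (t : ℚ) ≠ 0 := by exact_mod_cast ht.ne'
  rw [← expo_div_period, div_eq_div_iff h5 h6]
  linarith

open Classical in
/-- The projection of `∏ V_{sᵢ/rᵢ}` to the factors with slopes satisfying `P`. -/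
def mask (P : ℚ → Prop) : ((i : Fin d.m) → SimpleIso p k (d.r i) (d.s i)) →ₗ[KBar p k]
    ((i : Fin d.m) → SimpleIso p k (d.r i) (d.s i)) :=
  LinearMap.pi fun i => if P (d.slope i) then LinearMap.proj i else 0

open Classical in
theorem mask_apply (P : ℚ → Prop) (f : (i : Fin d.m) → SimpleIso p k (d.r i) (d.s i))
    (i : Fin d.m) : d.mask P f i = if P (d.slope i) then f i else 0 := by
  rw [mask, LinearMap.pi_apply]
  split_ifs <;> rfl

/-- The projection of `K' ⊗ M` to the part with slopes satisfying `P`. -/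
def proj (P : ℚ → Prop) : IsoSpace p k M →ₗ[KBar p k] IsoSpace p k M :=
  d.e.symm.toLinearMap ∘ₗ d.mask P ∘ₗ d.e.toLinearMap

theorem e_proj (P : ℚ → Prop) (z : IsoSpace p k M) : d.e (d.proj P z) = d.mask P (d.e z) := by
  simp [proj]

open Classical in
theorem proj_basis (P : ℚ → Prop) (b : d.Idx) :
    d.proj P (d.basis b) = if P (d.slope b.1) then d.basis b else 0 := by
  apply d.e.injective
  rw [e_proj]
  ext1 i
  rw [mask_apply, apply_ite d.e, e_basis, map_zero]
  by_cases h : i = b.1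
  · subst h
    split_ifs <;> simp
  · rw [Pi.single_eq_of_ne h]
    split_ifs <;> simp [Pi.single_eq_of_ne h]

open Classical in
theorem repr_proj (P : ℚ → Prop) (x : IsoSpace p k M) (b : d.Idx) :
    d.basis.repr (d.proj P x) b = if P (d.slope b.1) then d.basis.repr x b else 0 := by
  have h : d.proj P x = ∑ c, (if P (d.slope c.1) then d.basis.repr x c else 0) • d.basis c := by
    conv_lhs => rw [← d.basis.sum_repr x]
    rw [map_sum]
    refine Finset.sum_congr rfl fun c _ => ?_
    rw [map_smul, proj_basis]
    split_ifs <;> simp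
  rw [h, d.basis.repr_sum_self]

theorem proj_baseChange (P : ℚ → Prop) (z : IsoSpace p k M) :
    d.proj P (C.baseChange z) = C.baseChange (d.proj P z) := by
  apply d.e.injective
  ext1 i
  rw [d.comm, e_proj, e_proj, mask_apply, mask_apply, d.comm]
  split_ifs <;> simp

theorem proj_comp (P Q : ℚ → Prop) (z : IsoSpace p k M) :
    d.proj P (d.proj Q z) = d.proj (fun x => P x ∧ Q x) z := by
  classical
  apply d.e.injective
  ext1 i
  simp only [e_proj, mask_apply]
  split_ifs <;> simp_all

theorem proj_add_proj (P : ℚ → Prop) (z : IsoSpace p k M) :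
    d.proj P z + d.proj (fun x => ¬ P x) z = z := by
  classical
  apply d.e.injective
  rw [map_add]
  ext1 i
  simp only [Pi.add_apply, e_proj, mask_apply]
  split_ifs <;> simp_all

theorem proj_eq_self_of_iterate {P : ℚ → Prop} {t : ℕ} (ht : 0 < t) {m : ℤ} {x : IsoSpace p k M}
    (hx : C.baseChange^[t] x = (p : KBar p k) ^ m • x) (hP : P (m / t)) : d.proj P x = x := by
  classical
  apply d.basis.repr.injective
  ext b
  rw [repr_proj]
  split_ifs with h
  · rfl
  · by_contra h2
    exact h (d.slope_eq_of_iterate ht hx (Ne.symm h2) ▸ hP)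

theorem proj_eq_zero_of_iterate {P : ℚ → Prop} {t : ℕ} (ht : 0 < t) {m : ℤ} {x : IsoSpace p k M}
    (hx : C.baseChange^[t] x = (p : KBar p k) ^ m • x) (hP : ¬ P (m / t)) : d.proj P x = 0 := by
  have h1 := d.proj_add_proj P x
  rw [d.proj_eq_self_of_iterate (P := fun x => ¬ P x) ht hx hP] at h1
  simpa using h1

theorem map_slope_univ : (Finset.univ.val.map fun b : d.Idx => d.slope b.1) = d.slopes := by
  have h : (Finset.univ.val.map fun b : d.Idx => d.slope b.1) = ∑ b : d.Idx, {d.slope b.1} := by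
    conv_lhs => rw [← Multiset.sum_map_singleton (Multiset.map _ _), Multiset.map_map]
    rfl
  rw [h, slopes, Fintype.sum_sigma]
  refine Finset.sum_congr rfl fun i _ => ?_
  simp [simplePoly_natDegree, Multiset.nsmul_singleton]

theorem sum_slopes : d.slopes.sum = ∑ b : d.Idx, d.slope b.1 := by
  rw [← map_slope_univ]; rfl

theorem card_slopes : Multiset.card d.slopes = Fintype.card d.Idx := by
  rw [← map_slope_univ, Multiset.card_map]; rfl

end SlopeDecomposition

theorem isNewtonSlopes_iff (C : FCrystal p k M) (l : List ℚ) :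
    IsNewtonSlopes C l ↔
      l.Pairwise (· ≤ ·) ∧ ∃ d : SlopeDecomposition C, (l : Multiset ℚ) = d.slopes := by
  constructor
  · rintro ⟨h, m, r, s, hrs, ⟨e, he⟩, hl⟩
    exact ⟨h, ⟨m, r, s, fun i => (hrs i).1, fun i => (hrs i).2, e, he⟩, hl⟩
  · rintro ⟨h, d, hl⟩
    exact ⟨h, d.m, d.r, d.s, fun i => ⟨d.pos i, d.coprime i⟩, ⟨d.e, d.comm⟩, hl⟩

end

/-! ### Base change of crystals and Galois descent of slope projections. -/

section

variable {p : ℕ} [Fact p.Prime] {k : Type*} [Field k] [CharP k p] [PerfectRing k p]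
variable {M : Type*} [AddCommGroup M] [Module (WittVector p k) M]
variable {S : Type*} [AddCommGroup S] [Module (WittVector p k) S]

/-- Allows identities in `M` to be checked in `K' ⊗ M`, where slope projections exist. -/
theorem FCrystal.one_tmul_injective (C : FCrystal p k M) :
    Function.Injective fun m : M => (1 : KBar p k) ⊗ₜ[WittVector p k] m := by
  have := C.free
  intro x y hxy
  let u := Module.Free.chooseBasis (WittVector p k) M
  apply u.repr.injective
  refine Finsupp.ext fun i => ?_
  have h := congrArg (fun z => (u.baseChange (KBar p k)).repr z i) hxy
  simp only [Module.Basis.baseChange_repr_tmul, Algebra.smul_def, mul_one] at h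
  exact algebraMap_kBar_injective h

theorem FCrystal.baseChange_tmul (C : FCrystal p k M) (x : KBar p k) (m : M) :
    C.baseChange (x ⊗ₜ[WittVector p k] m) = kBarFrob p k x ⊗ₜ[WittVector p k] C.F m :=
  rfl

theorem FCrystal.iterate_baseChange_one_tmul (C : FCrystal p k M) (j : ℕ) (m : M) :
    C.baseChange^[j] ((1 : KBar p k) ⊗ₜ[WittVector p k] m) = 1 ⊗ₜ[WittVector p k] (C.F^[j] m) := by
  induction j with
  | zero => rfl
  | succ j ih => rw [Function.iterate_succ_apply', ih, C.baseChange_tmul, map_one,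
      ← Function.iterate_succ_apply' C.F]

theorem FCrystal.baseChange_map {C : FCrystal p k M} {E : FCrystal p k S}
    (f : S →ₗ[WittVector p k] M) (hf : ∀ x, f (E.F x) = C.F (f x)) (z : IsoSpace p k S) :
    f.baseChange (KBar p k) (E.baseChange z) = C.baseChange (f.baseChange (KBar p k) z) := by
  induction z using TensorProduct.induction_on with
  | zero => simp
  | add a b ha hb => simp only [map_add, ha, hb]
  | tmul x m => simp only [FCrystal.baseChange_tmul, LinearMap.baseChange_tmul, hf]

theorem FCrystal.iterate_baseChange_map {C : FCrystal p k M} {E : FCrystal p k S}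
    {j : IsoSpace p k S →ₗ[KBar p k] IsoSpace p k M}
    (hj : ∀ x, j (E.baseChange x) = C.baseChange (j x)) (t : ℕ) (z : IsoSpace p k S) :
    j (E.baseChange^[t] z) = C.baseChange^[t] (j z) := by
  induction t with
  | zero => rfl
  | succ t ih => rw [Function.iterate_succ_apply', hj, ih, Function.iterate_succ_apply']

namespace SlopeDecomposition

variable {C : FCrystal p k M} (d : SlopeDecomposition C)

/-- Reindexing of the factors of a decomposition whose index type is any finite type. -/
theorem exists_of_fintype {ι : Type} [Fintype ι] (r : ι → ℕ) (s : ι → ℤ)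
    (pos : ∀ i, 0 < r i) (coprime : ∀ i, IsCoprime (s i) (r i : ℤ))
    (e : IsoSpace p k M ≃ₗ[KBar p k] ((i : ι) → SimpleIso p k (r i) (s i)))
    (comm : ∀ z i, e (C.baseChange z) i = simpleFrob p k (r i) (s i) (e z i)) :
    ∃ d : SlopeDecomposition C,
      d.slopes = ∑ i, Multiset.replicate (r i) ((s i : ℚ) / (r i : ℚ)) := by
  let f := Fintype.equivFin ι
  refine ⟨⟨Fintype.card ι, fun i => r (f.symm i), fun i => s (f.symm i), fun i => pos _,
    fun i => coprime _,
    e.trans (LinearEquiv.piCongrLeft' (KBar p k) (fun i => SimpleIso p k (r i) (s i)) f),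
    fun z i => comm z (f.symm i)⟩, ?_⟩
  exact Fintype.sum_equiv f.symm _ _ fun i => rfl

/-- The maps `j` and `q` identify `K' ⊗ S` with the image of the slope projection, which is the
product of the simple factors whose slope satisfies `P`. -/
theorem exists_of_retract {E : FCrystal p k S} (P : ℚ → Prop) [DecidablePred P]
    (j : IsoSpace p k S →ₗ[KBar p k] IsoSpace p k M)
    (q : IsoSpace p k M →ₗ[KBar p k] IsoSpace p k S)
    (hqj : ∀ x, q (j x) = x) (hjq : ∀ z, j (q z) = d.proj P z)
    (hj : ∀ x, j (E.baseChange x) = C.baseChange (j x)) :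
    ∃ d' : SlopeDecomposition E, d'.slopes = d.slopes.filter P := by
  let I := {i : Fin d.m // P (d.slope i)}
  -- Extension by zero from the selected factors; `res` below is the restriction to them.
  let ext : ((i : I) → SimpleIso p k (d.r i) (d.s i)) →ₗ[KBar p k]
      ((i : Fin d.m) → SimpleIso p k (d.r i) (d.s i)) :=
    LinearMap.pi fun i => if h : P (d.slope i) then LinearMap.proj (⟨i, h⟩ : I) else 0
  have hext : ∀ f i, (h : P (d.slope i)) → ext f i = f ⟨i, h⟩ := by
    intro f i h
    simp only [ext, LinearMap.pi_apply, dif_pos h, LinearMap.proj_apply]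
  have hext' : ∀ f i, (h : ¬ P (d.slope i)) → ext f i = 0 := by
    intro f i h
    simp only [ext, LinearMap.pi_apply, dif_neg h, LinearMap.zero_apply]
  let res : ((i : Fin d.m) → SimpleIso p k (d.r i) (d.s i)) →ₗ[KBar p k]
      ((i : I) → SimpleIso p k (d.r i) (d.s i)) :=
    LinearMap.pi fun i => LinearMap.proj i.1
  have hres : ∀ f, ext (res f) = d.mask P f := by
    intro f
    ext1 i
    rw [mask_apply]
    split_ifs with h
    · rw [hext _ _ h]; rfl
    · rw [hext' _ _ h]
  have hmask : ∀ f, d.mask P (ext f) = ext f := by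
    intro f
    ext1 i
    rw [mask_apply]
    split_ifs with h
    · rfl
    · rw [hext' _ _ h]
  have hresext : ∀ f, res (ext f) = f := fun f => by
    ext1 i
    exact hext f i.1 i.2
  have hproj : ∀ x, d.mask P (d.e (j x)) = d.e (j x) := by
    intro x
    rw [← e_proj, ← hjq, hqj]
  let e' : IsoSpace p k S ≃ₗ[KBar p k] ((i : I) → SimpleIso p k (d.r i) (d.s i)) :=
    LinearEquiv.ofLinearMap (res ∘ₗ d.e.toLinearMap ∘ₗ j) (q ∘ₗ d.e.symm.toLinearMap ∘ₗ ext)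
      (by
        apply LinearMap.ext
        intro f
        simp only [LinearMap.comp_apply, LinearEquiv.coe_coe, LinearMap.id_apply]
        rw [hjq, e_proj, LinearEquiv.apply_symm_apply, hmask, hresext])
      (by
        apply LinearMap.ext
        intro x
        simp only [LinearMap.comp_apply, LinearEquiv.coe_coe, LinearMap.id_apply]
        rw [hres, hproj, LinearEquiv.symm_apply_apply, hqj])
  obtain ⟨d', hd'⟩ := exists_of_fintype (C := E) (fun i : I => d.r i) (fun i : I => d.s i)
    (fun i => d.pos i) (fun i => d.coprime i) e' (fun z i => by
      change d.e (j (E.baseChange z)) i.1 = _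
      rw [hj, d.comm]; rfl)
  refine ⟨d', hd'.trans ?_⟩
  let φ : Multiset ℚ →+ Multiset ℚ := ⟨⟨Multiset.filter P, rfl⟩, Multiset.filter_add P⟩
  have hφ : d.slopes.filter P = ∑ i, (Multiset.replicate (d.r i) (d.slope i)).filter P :=
    map_sum φ _ _
  have h1 : ∀ i, (Multiset.replicate (d.r i) (d.slope i)).filter P =
      if P (d.slope i) then Multiset.replicate (d.r i) (d.slope i) else 0 := by
    intro i
    split_ifs with h
    · exact Multiset.filter_eq_self.mpr fun x hx => by rwa [Multiset.eq_of_mem_replicate hx]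
    · exact Multiset.filter_eq_nil.mpr fun x hx => by rwa [Multiset.eq_of_mem_replicate hx]
  rw [hφ, Finset.sum_congr rfl fun i _ => h1 i, ← Finset.sum_filter]
  rw [Finset.sum_subtype (Finset.univ.filter fun i => P (d.slope i)) (p := fun i => P (d.slope i))
    (by intro x; simp)]
  rfl

theorem galois_smul (γ : AlgebraicClosure k ≃ₐ[k] AlgebraicClosure k) (c : KBar p k)
    (z : IsoSpace p k M) :
    (galKBar γ).toLinearMap.rTensor M (c • z) =
      galKBar γ c • (galKBar γ).toLinearMap.rTensor M z := by
  induction z using TensorProduct.induction_on with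
  | zero => simp
  | add a b ha hb => simp only [smul_add, map_add, ha, hb]
  | tmul x m => simp [TensorProduct.smul_tmul']

theorem galois_baseChange (C : FCrystal p k M) (γ : AlgebraicClosure k ≃ₐ[k] AlgebraicClosure k)
    (z : IsoSpace p k M) :
    (galKBar γ).toLinearMap.rTensor M (C.baseChange z) =
      C.baseChange ((galKBar γ).toLinearMap.rTensor M z) := by
  induction z using TensorProduct.induction_on with
  | zero => simp
  | add a b ha hb => simp only [map_add, ha, hb]
  | tmul x m => simp [FCrystal.baseChange_tmul, galKBar_kBarFrob]

theorem galois_iterate (C : FCrystal p k M) (γ : AlgebraicClosure k ≃ₐ[k] AlgebraicClosure k)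
    (t : ℕ) (z : IsoSpace p k M) :
    (galKBar γ).toLinearMap.rTensor M (C.baseChange^[t] z) =
      C.baseChange^[t] ((galKBar γ).toLinearMap.rTensor M z) := by
  induction t with
  | zero => rfl
  | succ t ih =>
    rw [Function.iterate_succ_apply', galois_baseChange, ih, Function.iterate_succ_apply']

/-- An automorphism commutes with Frobenius and fixes `p`, so it carries an eigenvector `F ^ N z = p
^ m z` to an eigenvector with the same `m`, hence of the same slope. -/
theorem galois_proj (P : ℚ → Prop) (γ : AlgebraicClosure k ≃ₐ[k] AlgebraicClosure k)
    (z : IsoSpace p k M) :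
    (galKBar γ).toLinearMap.rTensor M (d.proj P z) =
      d.proj P ((galKBar γ).toLinearMap.rTensor M z) := by
  classical
  rw [← d.basis.sum_repr z, map_sum, map_sum, map_sum, map_sum]
  refine Finset.sum_congr rfl fun b _ => ?_
  rw [map_smul, galois_smul, galois_smul, map_smul]
  congr 1
  have h : C.baseChange^[d.period] ((galKBar γ).toLinearMap.rTensor M (d.basis b)) =
      (p : KBar p k) ^ d.expo b • (galKBar γ).toLinearMap.rTensor M (d.basis b) := by
    rw [← galois_iterate, iterate_basis, galois_smul, map_zpow₀, map_natCast]
  rw [proj_basis]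
  split_ifs with hP
  · rw [d.proj_eq_self_of_iterate d.period_pos h]
    rwa [← expo_div_period] at hP
  · rw [d.proj_eq_zero_of_iterate d.period_pos h, map_zero]
    rwa [← expo_div_period] at hP

theorem exists_isInt_finite {ι : Type*} [Finite ι] (f : ι → KBar p k) :
    ∃ c : ℕ, ∀ i, IsInt (-c) (f i) := by
  have := Fintype.ofFinite ι
  refine ⟨∑ i, (-valK (f i)).toNat, fun i => .of_le_valK ?_⟩
  have : (-valK (f i)).toNat ≤ ∑ i, (-valK (f i)).toNat :=
    Finset.single_le_sum (f := fun i => (-valK (f i)).toNat) (fun i _ => Nat.zero_le _)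
      (Finset.mem_univ i)
  omega

/-- A multiple of the projection to a slope part is defined over `W(k)`. -/
theorem exists_integral_multiple (P : ℚ → Prop) :
    ∃ (c : ℕ) (g : M →ₗ[WittVector p k] M),
      ∀ z, g.baseChange (KBar p k) z = (p : KBar p k) ^ c • d.proj P z := by
  have := C.free
  have := C.finite
  let u := Module.Free.chooseBasis (WittVector p k) M
  let u' := u.baseChange (KBar p k)
  let a : Module.Free.ChooseBasisIndex (WittVector p k) M ×
      Module.Free.ChooseBasisIndex (WittVector p k) M → KBar p k :=
    fun ij => u'.repr (d.proj P (u' ij.2)) ij.1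
  obtain ⟨c, hc⟩ := exists_isInt_finite a
  -- The basis `1 ⊗ uᵢ` is Galois-fixed, so equivariance of the projection makes its matrix entries
  -- Galois-fixed; `c` bounds their denominators.
  have hfix : ∀ ij γ, galKBar γ (a ij) = a ij := by
    intro ij γ
    have h1 : d.proj P (u' ij.2) = ∑ i, a (i, ij.2) • u' i := (u'.sum_repr _).symm
    have hu : ∀ i, (galKBar γ).toLinearMap.rTensor M (u' i) = u' i := by
      intro i
      simp [u']
    have h2 : d.proj P (u' ij.2) = ∑ i, galKBar γ (a (i, ij.2)) • u' i := by
      have := d.galois_proj P γ (u' ij.2)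
      rw [hu] at this
      rw [← this, h1, map_sum]
      exact Finset.sum_congr rfl fun i _ => by rw [galois_smul, hu]
    have h3 : u'.repr (d.proj P (u' ij.2)) ij.1 = galKBar γ (a (ij.1, ij.2)) := by
      rw [h2, u'.repr_sum_self]
    exact h3.symm
  choose w hw using fun ij => exists_algebraMap_of_galKBar_fixed (hfix ij) (hc ij)
  refine ⟨c, u.constr ℕ (fun j => ∑ i, w (i, j) • u i), fun z => ?_⟩
  have : (u.constr ℕ (fun j => ∑ i, w (i, j) • u i)).baseChange (KBar p k) =
      (p : KBar p k) ^ c • d.proj P := by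
    apply u'.ext
    intro j
    rw [LinearMap.smul_apply, ← u'.sum_repr (d.proj P (u' j)), Finset.smul_sum]
    simp only [u', Module.Basis.baseChange_apply, LinearMap.baseChange_tmul, Module.Basis.constr_basis,
      TensorProduct.tmul_sum]
    refine Finset.sum_congr rfl fun i _ => ?_
    rw [TensorProduct.tmul_smul, smul_smul, TensorProduct.smul_tmul', TensorProduct.smul_tmul',
      Algebra.smul_def, hw]
    simp [a, u']
  rw [this]
  rfl

end SlopeDecomposition

end

/-! ### Hodge slopes as elementary divisors. -/

section

/-- Otherwise every term of the Leibniz expansion would lie in the maximal ideal. -/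
theorem exists_perm_isUnit_of_isUnit_det {R ι : Type*} [CommRing R] [IsLocalRing R] [Fintype ι]
    [DecidableEq ι] {A : Matrix ι ι R} (hA : IsUnit A.det) :
    ∃ τ : Equiv.Perm ι, ∀ i, IsUnit (A (τ i) i) := by
  by_contra! h
  refine (IsLocalRing.mem_maximalIdeal A.det).mp ?_ hA
  rw [Matrix.det_apply']
  refine Ideal.sum_mem _ fun τ _ => Ideal.mul_mem_left _ _ ?_
  obtain ⟨i, hi⟩ := h τ
  exact Ideal.mem_of_dvd _ (Finset.dvd_prod_of_mem (fun i => A (τ i) i) (Finset.mem_univ i))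
    ((IsLocalRing.mem_maximalIdeal _).mpr hi)

variable {p : ℕ} [Fact p.Prime] {k : Type*} [Field k] [CharP k p] [PerfectRing k p]

theorem pow_p_dvd_pow_p_iff {a b : ℕ} :
    (p : WittVector p k) ^ a ∣ (p : WittVector p k) ^ b ↔ a ≤ b :=
  pow_dvd_pow_iff (WittVector.p_nonzero p k) (WittVector.irreducible p).not_isUnit

/-- Two unimodular matrices which differ by scaling rows and columns by powers of `p`. -/
theorem exists_perm_add_eq {ι : Type*} [Fintype ι] [DecidableEq ι]
    {Q R : Matrix ι ι (WittVector p k)} (hQ : IsUnit Q.det) (hR : IsUnit R.det) (s t : ι → ℕ)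
    (D : ℕ) (h : ∀ i j, (p : WittVector p k) ^ (s i + t j) * Q i j = (p : WittVector p k) ^ D * R i j) :
    ∃ τ : Equiv.Perm ι, ∀ j, s (τ j) + t j = D := by
  obtain ⟨τ, hτ⟩ := exists_perm_isUnit_of_isUnit_det hQ
  obtain ⟨τ', hτ'⟩ := exists_perm_isUnit_of_isUnit_det hR
  -- Unit entries of `Q` along `τ` bound the exponents below by `D`, unit entries of `R` along `τ'`
  -- bound them above. The total of `s + t` does not depend on the permutation, so the bounds along
  -- `τ` are equalities.
  have h1 : ∀ j, D ≤ s (τ j) + t j := fun j => by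
    rw [← pow_p_dvd_pow_p_iff (p := p) (k := k), ← (hτ j).dvd_mul_right, h]
    exact dvd_mul_right _ _
  have h2 : ∀ j, s (τ' j) + t j ≤ D := fun j => by
    rw [← pow_p_dvd_pow_p_iff (p := p) (k := k), ← (hτ' j).dvd_mul_right, ← h]
    exact dvd_mul_right _ _
  have h3 : ∑ j, (s (τ j) + t j) = ∑ j, (s (τ' j) + t j) := by
    rw [Finset.sum_add_distrib, Finset.sum_add_distrib, Equiv.sum_comp, Equiv.sum_comp]
  have h4 : ∑ j : ι, D = ∑ j, (s (τ j) + t j) :=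
    le_antisymm (Finset.sum_le_sum fun j _ => h1 j)
      (h3 ▸ Finset.sum_le_sum fun j _ => h2 j)
  exact ⟨τ, fun j => ((Finset.sum_eq_sum_iff_of_le fun j _ => h1 j).mp h4 j (Finset.mem_univ j)).symm⟩

variable {M : Type*} [AddCommGroup M] [Module (WittVector p k) M]
variable {S : Type*} [AddCommGroup S] [Module (WittVector p k) S]

/-- Two bases of `M` in which the Frobenius is diagonal. -/
structure HodgeBases (C : FCrystal p k M) (ι : Type*) where
  v : Module.Basis ι (WittVector p k) M
  w : Module.Basis ι (WittVector p k) M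
  e : ι → ℕ
  h : ∀ i, C.F (v i) = (p : WittVector p k) ^ e i • w i

namespace HodgeBases

variable {C : FCrystal p k M} {E : FCrystal p k S} {ι : Type*}

def reindex {κ : Type*} (H : HodgeBases C ι) (f : ι ≃ κ) : HodgeBases C κ where
  v := H.v.reindex f
  w := H.w.reindex f
  e := H.e ∘ f.symm
  h i := by simp [H.h]

/-- The multiset of Hodge slopes. -/
def slopes [Fintype ι] (H : HodgeBases C ι) : Multiset ℕ := Finset.univ.val.map H.e

theorem slopes_reindex {κ : Type*} [Fintype ι] [Fintype κ] (H : HodgeBases C ι) (f : ι ≃ κ) :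
    (H.reindex f).slopes = H.slopes := by
  have h : (Finset.univ : Finset ι).val = Multiset.map f.symm Finset.univ.val := by
    rw [← Finset.map_univ_equiv f.symm]; rfl
  rw [slopes, slopes, h, Multiset.map_map]
  rfl

theorem isHodgeSlopes [Fintype ι] (H : HodgeBases C ι) {a : List ℕ} (ha : a.Pairwise (· ≤ ·))
    (h : (a : Multiset ℕ) = H.slopes) : IsHodgeSlopes C a := by
  let H' := H.reindex (Fintype.equivFin ι)
  rw [← H.slopes_reindex (Fintype.equivFin ι)] at h
  change _ = H'.slopes at h
  have h1 : a = List.ofFn (H'.e ∘ Tuple.sort H'.e) := by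
    refine List.Perm.eq_of_pairwise' ha ?_ ?_
    · rw [List.pairwise_ofFn]
      exact fun i j hij => Tuple.monotone_sort H'.e hij.le
    · rw [← Multiset.coe_eq_coe, h, slopes]
      have h2 : (Finset.univ : Finset (Fin (Fintype.card ι))).val =
          Multiset.map (Tuple.sort H'.e) Finset.univ.val := by
        conv_lhs => rw [← Finset.map_univ_equiv (Tuple.sort H'.e)]
        rfl
      conv_lhs => rw [h2, Multiset.map_map]
      rw [← List.map_ofFn]
      simp [Fin.univ_def, List.ofFn_eq_map]
  subst h1
  let f := (Tuple.sort H'.e).symm.trans (finCongr (List.length_ofFn (f := H'.e ∘ Tuple.sort H'.e)).symm)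
  let H'' := H'.reindex f
  refine ⟨ha, H''.v, H''.w, fun i => ?_⟩
  rw [H''.h]
  congr 2
  rw [List.get_ofFn]
  rfl

end HodgeBases

theorem IsHodgeSlopes.exists_hodgeBases {C : FCrystal p k M} {a : List ℕ} (ha : IsHodgeSlopes C a) :
    ∃ H : HodgeBases C (Fin a.length), H.slopes = a ∧ H.e = a.get := by
  obtain ⟨_, v, w, h⟩ := ha
  refine ⟨⟨v, w, a.get, h⟩, ?_, rfl⟩
  simp [HodgeBases.slopes, Fin.univ_def]

namespace HodgeBases

variable {C : FCrystal p k M} {E : FCrystal p k S} {ι : Type*}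

instance : RingHomSurjective (wittFrob p k) :=
  ⟨(WittVector.frobenius_bijective p k).surjective⟩

theorem linearIndependent_frob (C : FCrystal p k M) {v : ι → M}
    (hv : LinearIndependent (WittVector p k) v) :
    LinearIndependent (WittVector p k) fun i => C.F (v i) := by
  rw [linearIndependent_iff'] at hv ⊢
  intro s g hg i hi
  choose g' hg' using fun i => (WittVector.frobenius_bijective p k).surjective (g i)
  have h1 : C.F (∑ i ∈ s, g' i • v i) = 0 := by
    rw [map_sum, ← hg]
    exact Finset.sum_congr rfl fun i _ => by rw [LinearMap.map_smulₛₗ, ← hg' i]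
  have h2 := hv s g' (C.injective (by rw [h1, map_zero])) i hi
  rw [← hg' i, h2, map_zero]

/-- As `σ` is bijective, `F(M)` is a `W(k)`-submodule of full rank. Its Smith normal form gives `w`
once the unit parts of the elementary divisors are absorbed, and the `F`-preimages of the adapted
basis of `F(M)` give `v`. -/
theorem exists_of_basis [Fintype ι] (C : FCrystal p k M)
    (b : Module.Basis ι (WittVector p k) M) : Nonempty (HodgeBases C ι) := by
  classical
  have := C.free
  have := C.finite
  have hb0 : ∀ (b : Module.Basis ι (WittVector p k) M), Submodule.span (WittVector p k)
      (Set.range fun i => C.F (b i)) = LinearMap.range C.F := by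
    intro b
    apply le_antisymm
    · rw [Submodule.span_le]
      rintro _ ⟨i, rfl⟩
      exact ⟨_, rfl⟩
    · rintro _ ⟨m, rfl⟩
      rw [← b.sum_repr m, map_sum]
      refine Submodule.sum_mem _ fun i _ => ?_
      rw [LinearMap.map_smulₛₗ]
      exact Submodule.smul_mem _ _ (Submodule.subset_span ⟨i, rfl⟩)
  have hrank : Module.finrank (WittVector p k) (LinearMap.range C.F) =
      Module.finrank (WittVector p k) M := by
    rw [← hb0 b, finrank_span_eq_card (linearIndependent_frob C b.linearIndependent),
      Module.finrank_eq_card_basis b]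
  obtain ⟨b', a, ab, hab⟩ := Submodule.exists_smith_normal_form_of_rank_eq b hrank
  have ha : ∀ i, a i ≠ 0 := fun i hi => ab.ne_zero i (by
    apply Subtype.ext
    rw [hab, hi, zero_smul]; rfl)
  choose e u hu using fun i => WittVector.exists_eq_pow_p_mul' (a i) (ha i)
  choose v hv using fun i => LinearMap.mem_range.mp (ab i).2
  have hvF : ∀ i, C.F (v i) = (p : WittVector p k) ^ e i • (b'.unitsSMul u) i := by
    intro i
    rw [hv, hab, Module.Basis.unitsSMul_apply, hu, mul_smul]
    rfl
  have hli : LinearIndependent (WittVector p k) v := by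
    have h1 : LinearIndependent (WittVector p k) fun i => C.F (v i) := by
      have := ab.linearIndependent.map' (LinearMap.range C.F).subtype (Submodule.ker_subtype _)
      convert! this using 1
      ext1 i
      exact hv i
    rw [linearIndependent_iff'] at h1 ⊢
    intro s g hg i hi
    have h2 := h1 s (fun i => WittVector.frobenius (g i)) (by
      rw [← map_zero C.F, ← hg, map_sum]
      exact Finset.sum_congr rfl fun i _ => by rw [LinearMap.map_smulₛₗ]) i hi
    exact (WittVector.frobenius_bijective p k).injective (by rw [h2, map_zero])
  have hsp : ⊤ ≤ Submodule.span (WittVector p k) (Set.range v) := by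
    intro m _
    choose g hg using fun i => (WittVector.frobenius_bijective p k).surjective
      (ab.repr ⟨C.F m, LinearMap.mem_range_self _ m⟩ i)
    have h1 : m = ∑ i, g i • v i := by
      apply C.injective
      have h2 := congrArg Subtype.val (ab.sum_repr ⟨C.F m, LinearMap.mem_range_self _ m⟩)
      simp only [Submodule.coe_sum, Submodule.coe_smul] at h2
      rw [map_sum]
      refine h2.symm.trans (Finset.sum_congr rfl fun i _ => ?_)
      rw [LinearMap.map_smulₛₗ, hv, ← hg i]
    rw [h1]
    exact Submodule.sum_mem _ fun i _ => Submodule.smul_mem _ _ (Submodule.subset_span ⟨i, rfl⟩)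
  exact ⟨⟨Module.Basis.mk hli hsp, b'.unitsSMul u, e, fun i => by rw [Module.Basis.mk_apply, hvF]⟩⟩

theorem isUnit_det_map_frobenius [Fintype ι] [DecidableEq ι] {P : Matrix ι ι (WittVector p k)}
    (hP : IsUnit P.det) : IsUnit (P.map (wittFrob p k)).det := by
  have := (wittFrob p k).map_det P
  rw [RingHom.mapMatrix_apply] at this
  rw [← this]
  exact hP.map _

theorem slopes_eq_of_perm [Fintype ι] {e f : ι → ℕ} {τ : Equiv.Perm ι} (h : ∀ j, e (τ j) = f j) :
    Finset.univ.val.map e = Finset.univ.val.map f := by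
  have h2 : (Finset.univ : Finset ι).val = Multiset.map τ Finset.univ.val := by
    conv_lhs => rw [← Finset.map_univ_equiv τ]
    rfl
  rw [h2, Multiset.map_map, ← h2]
  exact Multiset.map_congr rfl fun j _ => h j

theorem slopes_unique {κ : Type*} [Fintype ι] [Fintype κ] (H : HodgeBases C ι)
    (H' : HodgeBases C κ) : H.slopes = H'.slopes := by
  classical
  rw [← H'.slopes_reindex (H'.v.indexEquiv H.v)]
  generalize H'.reindex (H'.v.indexEquiv H.v) = H'
  -- Any common bound of the exponents would do; it moves `p ^ H.e j` to the other side without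
  -- negative powers.
  let D := ∑ i, H.e i
  have hD : ∀ i, H.e i ≤ D := fun i => Finset.single_le_sum (fun _ _ => Nat.zero_le _)
    (Finset.mem_univ i)
  obtain ⟨τ, hτ⟩ := exists_perm_add_eq (p := p) (k := k)
    (Q := (H.w.toMatrix H'.w).transpose) (R := ((H.v.toMatrix H'.v).map (wittFrob p k)).transpose)
    (by rw [Matrix.det_transpose]; exact H.w.isUnit_det H'.w)
    (by rw [Matrix.det_transpose]; exact isUnit_det_map_frobenius (H.v.isUnit_det H'.v))
    H'.e (fun j => D - H.e j) D (by
      intro i j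
      have h1 := H'.h i
      rw [← H.v.sum_repr (H'.v i), map_sum] at h1
      simp only [LinearMap.map_smulₛₗ, H.h, smul_smul] at h1
      have h2 := congrArg (fun m => H.w.repr m j) h1
      simp only [H.w.repr_sum_self, map_smul, Finsupp.smul_apply, smul_eq_mul] at h2
      simp only [Matrix.transpose_apply, Matrix.map_apply, Module.Basis.toMatrix_apply]
      rw [pow_add, mul_right_comm, ← h2]
      conv_rhs => rw [← Nat.add_sub_cancel' (hD j), pow_add]
      ring)
  refine (slopes_eq_of_perm (τ := τ) fun j => ?_).symm
  have := hτ j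
  have := hD j
  omega

/-- The Hodge slopes of two crystals in duality. -/
theorem slopes_of_pairing [Fintype ι] (H : HodgeBases C ι) (H' : HodgeBases E ι)
    (B : M ≃ₗ[WittVector p k] Module.Dual (WittVector p k) S) (D : ℕ) (u : (WittVector p k)ˣ)
    (hB : ∀ x y, B (C.F x) (E.F y) = (p : WittVector p k) ^ D * u * wittFrob p k (B x y)) :
    ∃ τ : Equiv.Perm ι, ∀ j, H.e (τ j) + H'.e j = D := by
  classical
  have hdet : ∀ (b : Module.Basis ι (WittVector p k) M) (b' : Module.Basis ι (WittVector p k) S),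
      IsUnit (Matrix.of fun i j => B (b i) (b' j)).det := by
    intro b b'
    have h1 : (Matrix.of fun i j => B (b i) (b' j)) = (b'.dualBasis.toMatrix (b.map B)).transpose := by
      ext1 i j
      simp [Module.Basis.toMatrix_apply]
    rw [h1, Matrix.det_transpose]
    exact b'.dualBasis.isUnit_det (b.map B)
  -- Evaluating `hB` on `v` and `v'` shows that the Gram matrix of `w`, `w'`, scaled by `p ^ (eᵢ +
  -- e'ⱼ)`, is `p ^ D u` times the Frobenius twist of that of `v`, `v'`. Both Gram matrices are
  -- unimodular because `B` is an isomorphism.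
  refine exists_perm_add_eq (hdet H.w H'.w) (R := u.1 • (Matrix.of fun i j =>
    B (H.v i) (H'.v j)).map (wittFrob p k)) ?_ _ _ D fun i j => ?_
  · rw [Matrix.det_smul]
    exact (u.isUnit.pow _).mul (isUnit_det_map_frobenius (hdet H.v H'.v))
  · have h1 := hB (H.v i) (H'.v j)
    rw [H.h, H'.h, map_smul, map_smul, LinearMap.smul_apply, smul_eq_mul, smul_eq_mul] at h1
    simp only [Matrix.of_apply, Matrix.smul_apply, Matrix.map_apply, smul_eq_mul]
    rw [pow_add, ← mul_assoc _ u.1, ← h1]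
    ring

theorem det_semilinear [Fintype ι] [DecidableEq ι] {R V : Type*} [CommRing R] [AddCommGroup V]
    [Module R V] {σ : R →+* R} (b : Module.Basis ι R V) (Φ : V →ₛₗ[σ] V) (y : ι → V) :
    b.det (fun i => Φ (y i)) = b.det (fun i => Φ (b i)) * σ (b.det y) := by
  have h : b.toMatrix (fun i => Φ (y i)) =
      b.toMatrix (fun i => Φ (b i)) * σ.mapMatrix (b.toMatrix y) := by
    ext1 i j
    rw [Module.Basis.toMatrix_apply, ← b.sum_repr (y j), map_sum, map_sum, Finsupp.finsetSum_apply,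
      Matrix.mul_apply]
    refine Finset.sum_congr rfl fun l _ => ?_
    rw [LinearMap.map_smulₛₗ, map_smul, Finsupp.smul_apply, smul_eq_mul, mul_comm]
    simp [Module.Basis.toMatrix_apply]
  rw [b.det_apply, b.det_apply, b.det_apply, h, Matrix.det_mul, RingHom.map_det]

/-- The end points of the Hodge and Newton polygons agree. -/
theorem sum_eq_sum_slopes [Fintype ι] (H : HodgeBases C ι) (d : SlopeDecomposition C) :
    ((∑ i, H.e i : ℕ) : ℚ) = d.slopes.sum ∧ Multiset.card d.slopes = Fintype.card ι := by
  classical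
  let b := H.w.baseChange (KBar p k)
  let f : d.Idx ≃ ι := d.basis.indexEquiv b
  have hcard : Multiset.card d.slopes = Fintype.card ι := by
    rw [d.card_slopes]; exact Fintype.card_congr f
  refine ⟨?_, hcard⟩
  let z := d.basis.reindex f
  have hp : ∀ m : ℤ, (p : KBar p k) ^ m ≠ 0 := fun m => zpow_ne_zero m kBar_p_ne_zero
  -- The determinant of `F` has valuation the sum of the Hodge slopes, since `v` and `w` differ by a
  -- unimodular matrix. Applying `F ^ period` to the eigenbasis `z` shows that `period` times this
  -- valuation is the sum of the exponents `expo`.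
  let δ := b.det fun i => C.baseChange (b i)
  have hv : b.det (fun i => (1 : KBar p k) ⊗ₜ[WittVector p k] H.v i) =
      algebraMap (WittVector p k) (KBar p k) (H.w.det H.v) := by
    rw [b.det_apply, H.w.det_apply, RingHom.map_det]
    congr 1
    ext1 i j
    simp [b, Module.Basis.toMatrix_apply, Algebra.smul_def]
  have hδ : (p : KBar p k) ^ ((∑ i, H.e i : ℕ) : ℤ) =
      δ * kBarFrob p k (algebraMap (WittVector p k) (KBar p k) (H.w.det H.v)) := by
    rw [← hv, ← det_semilinear]
    have h1 : (fun i => C.baseChange ((1 : KBar p k) ⊗ₜ[WittVector p k] H.v i)) =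
        fun i => ((p : KBar p k) ^ H.e i) • b i := by
      ext1 i
      rw [C.baseChange_tmul, map_one, H.h, Module.Basis.baseChange_apply,
        TensorProduct.smul_tmul', smul_eq_mul, mul_one, ← TensorProduct.smul_tmul, Algebra.smul_def,
        mul_one, map_pow, map_natCast]
    rw [h1]
    have := b.det.map_smul_univ (fun i => (p : KBar p k) ^ H.e i) b
    rw [this, b.det_self, smul_eq_mul, mul_one, Finset.prod_pow_eq_pow_sum, zpow_natCast]
  have hunit := H.w.isUnit_det H.v
  have hne : kBarFrob p k (algebraMap (WittVector p k) (KBar p k) (H.w.det H.v)) ≠ 0 :=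
    ((hunit.map _).map _).ne_zero
  have hδ0 : δ ≠ 0 := left_ne_zero_of_mul (hδ ▸ hp _)
  have hval : valK δ = (∑ i, H.e i : ℕ) := by
    have := congrArg valK hδ
    rw [valK_zpow, valK_mul hδ0 hne, valK_kBarFrob, valK_algebraMap_unit hunit] at this
    linarith
  have hz0 : b.det z ≠ 0 := (b.isUnit_det z).ne_zero
  have hit : ∀ j : ℕ, b.det (fun i => C.baseChange^[j] (z i)) ≠ 0 ∧
      valK (b.det (fun i => C.baseChange^[j] (z i))) = j * valK δ + valK (b.det z) := by
    intro j
    induction j with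
    | zero => simpa using hz0
    | succ j ih =>
      simp only [Function.iterate_succ_apply']
      rw [det_semilinear]
      have h1 : kBarFrob p k (b.det (fun i => C.baseChange^[j] (z i))) ≠ 0 :=
        (map_ne_zero _).mpr ih.1
      refine ⟨mul_ne_zero hδ0 h1, ?_⟩
      rw [valK_mul hδ0 h1, valK_kBarFrob, ih.2]
      push_cast
      ring
  have h2 : (fun i => C.baseChange^[d.period] (z i)) =
      fun i => ((p : KBar p k) ^ d.expo (f.symm i)) • z i := by
    ext1 i
    simp only [z, Module.Basis.reindex_apply]
    rw [d.iterate_basis]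
  have h3 : ∀ s : Finset ι, ∏ i ∈ s, (p : KBar p k) ^ d.expo (f.symm i) =
      (p : KBar p k) ^ (∑ i ∈ s, d.expo (f.symm i)) := by
    intro s
    induction s using Finset.induction_on with
    | empty => simp
    | insert i s hi ih => rw [Finset.prod_insert hi, Finset.sum_insert hi, ih,
        zpow_add₀ kBar_p_ne_zero]
  have h4 := (hit d.period).2
  have h5 := b.det.map_smul_univ (fun i => (p : KBar p k) ^ d.expo (f.symm i)) z
  rw [h2, h5, smul_eq_mul, h3, valK_mul (hp _) hz0, valK_zpow, Equiv.sum_comp f.symm, hval] at h4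
  have h6 : (∑ b, d.expo b : ℤ) = d.period * (∑ i, H.e i : ℕ) := by linarith
  have h7 : (d.period : ℚ) ≠ 0 := by exact_mod_cast d.period_pos.ne'
  have h8 : (∑ b, (d.expo b : ℚ)) = d.period * (∑ i, H.e i : ℕ) := by exact_mod_cast h6
  rw [d.sum_slopes]
  simp only [← d.expo_div_period]
  rw [← Finset.sum_div, h8, mul_div_cancel_left₀ _ h7]

end HodgeBases

end

/-! ### Newton–Hodge decomposition by iterated retractions. -/

section

variable {p : ℕ} [Fact p.Prime] {k : Type*} [Field k] [CharP k p] [PerfectRing k p]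
variable {M : Type*} [AddCommGroup M] [Module (WittVector p k) M]

/-- The `F`-crystal on an `F`-stable submodule. -/
def FCrystal.sub (C : FCrystal p k M) (S : Submodule (WittVector p k) M)
    (hS : ∀ x ∈ S, C.F x ∈ S) : FCrystal p k S where
  free := by
    have := C.free
    have := C.finite
    infer_instance
  finite := by
    have := C.free
    have := C.finite
    infer_instance
  F :=
    { toFun := fun x => ⟨C.F x, hS x x.2⟩
      map_add' := fun x y => Subtype.ext (by simp)
      map_smul' := fun r x => Subtype.ext (by simp) }
  injective := fun x y hxy => Subtype.ext (C.injective (congrArg Subtype.val hxy))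

theorem FCrystal.sub_apply (C : FCrystal p k M) (S : Submodule (WittVector p k) M)
    (hS : ∀ x ∈ S, C.F x ∈ S) (x : S) : ((C.sub S hS).F x : M) = C.F x := rfl

/-- The minors of the matrix of the Frobenius are divisible by the minors of its Hodge form. -/
theorem HodgeBases.pow_dvd_minor {C : FCrystal p k M} {ι κ : Type*} [Fintype ι] [Fintype κ]
    [DecidableEq κ] (H : HodgeBases C ι) {B : ℕ}
    (hB : ∀ f : κ → ι, Function.Injective f → B ≤ ∑ i, H.e (f i)) (u : κ → M)
    (φ : κ → Module.Dual (WittVector p k) M) :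
    (p : WittVector p k) ^ B ∣ (Matrix.of fun c r => φ r (C.F (u c))).det := by
  classical
  have h1 : (Matrix.of fun c r => φ r (C.F (u c))) = Matrix.of fun c =>
      ∑ i : ι, (wittFrob p k (H.v.repr (u c) i) * (p : WittVector p k) ^ H.e i) •
        fun r => φ r (H.w i) := by
    ext1 c r
    simp only [Matrix.of_apply, Finset.sum_apply, Pi.smul_apply]
    conv_lhs => rw [← H.v.sum_repr (u c)]
    simp only [map_sum, LinearMap.map_smulₛₗ, H.h, map_smul, smul_eq_mul, mul_assoc]
  rw [h1]
  change _ ∣ Matrix.detRowAlternating (fun c => ∑ i : ι, (wittFrob p k (H.v.repr (u c) i) *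
    (p : WittVector p k) ^ H.e i) • fun r => φ r (H.w i))
  have h2 := (Matrix.detRowAlternating (n := κ) (R := WittVector p k)).toMultilinearMap.map_sum
    (fun c (i : ι) => (wittFrob p k (H.v.repr (u c) i) * (p : WittVector p k) ^ H.e i) •
      fun r => φ r (H.w i))
  rw [AlternatingMap.coe_multilinearMap] at h2
  rw [h2]
  refine Finset.dvd_sum fun f _ => ?_
  have h3 := (Matrix.detRowAlternating (n := κ) (R := WittVector p k)).map_smul_univ
    (fun c => wittFrob p k (H.v.repr (u c) (f c)) * (p : WittVector p k) ^ H.e (f c))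
    (fun c r => φ r (H.w (f c)))
  rw [h3, smul_eq_mul, Finset.prod_mul_distrib, Finset.prod_pow_eq_pow_sum]
  -- In the multilinear expansion, a choice `f` with a repeated index contributes two equal rows; an
  -- injective one contributes a factor `p ^ ∑ H.e (f c)`, covered by `hB`.
  by_cases hf : Function.Injective f
  · exact Dvd.dvd.mul_right (Dvd.dvd.mul_left (pow_dvd_pow _ (hB f hf)) _) _
  · have h4 : Matrix.detRowAlternating (fun c r => φ r (H.w (f c))) = 0 := by
      simp only [Function.Injective, not_forall] at hf
      obtain ⟨i, j, hij, hne⟩ := hf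
      exact AlternatingMap.map_eq_zero_of_eq _ _ (by rw [hij]) hne
    rw [h4, mul_zero]
    exact dvd_zero _

/-- If the Hodge polygon of a stable submodule `S` ends on the Hodge polygon of `M`, the Frobenius
of `S` divides every retraction of the Frobenius of `M`. -/
theorem HodgeBases.exists_frob_eq_retraction {C : FCrystal p k M} {ι κ : Type*} [Fintype ι]
    [Fintype κ] (H : HodgeBases C ι) {S : Submodule (WittVector p k) M}
    {hS : ∀ x ∈ S, C.F x ∈ S} (H' : HodgeBases (C.sub S hS) κ)
    (hB : ∀ f : κ → ι, Function.Injective f → ∑ i, H'.e i ≤ ∑ i, H.e (f i))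
    {ρ : M →ₗ[WittVector p k] S} (hρ : ∀ x : S, ρ x = x) (z : M) :
    ∃ y : S, (C.sub S hS).F y = ρ (C.F z) := by
  classical
  have hp := WittVector.p_nonzero p k
  let x : κ → WittVector p k := fun i => H'.w.repr (ρ (C.F z)) i
  -- Replace the `i`-th basis vector of `S` by `z`: the matrix of `ρ ∘ F` becomes diagonal except
  -- for row `i`, and its determinant is `x i` times the remaining powers of `p`. The minor bound
  -- says that the full power `∑ H'.e` divides it.
  have key : ∀ i, (p : WittVector p k) ^ H'.e i ∣ x i := by
    intro i
    have h1 := H.pow_dvd_minor hB (Function.update (fun c => (H'.v c : M)) i z)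
      (fun r => H'.w.coord r ∘ₗ ρ)
    let Δ : Matrix κ κ (WittVector p k) :=
      Matrix.diagonal fun c => (p : WittVector p k) ^ H'.e c
    have h2 : (Matrix.of fun c r => (H'.w.coord r ∘ₗ ρ)
        (C.F (Function.update (fun c => (H'.v c : M)) i z c))) = Δ.updateRow i x := by
      ext1 c r
      rcases eq_or_ne c i with rfl | hc
      · simp [x]
      · have h3 : C.F (H'.v c : M) = (((p : WittVector p k) ^ H'.e c • H'.w c : S) : M) := by
          rw [← H'.h c]; rfl
        rw [Matrix.of_apply, Function.update_of_ne hc, h3, LinearMap.comp_apply, hρ, map_smul,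
          Module.Basis.coord_apply, H'.w.repr_self, Matrix.updateRow_ne hc]
        simp only [Δ, Matrix.diagonal_apply, Finsupp.single_apply, smul_eq_mul, mul_ite, mul_one,
          mul_zero]
    rw [h2] at h1
    have h4 := Matrix.mulVec_cramer Δ.transpose x
    have h5 := congrFun h4 i
    rw [Matrix.diagonal_transpose, Matrix.mulVec_diagonal, Matrix.det_diagonal,
      Finset.prod_pow_eq_pow_sum, Pi.smul_apply, smul_eq_mul, Matrix.cramer_apply] at h5
    have h6 : (Δ.updateRow i x).det = ((Matrix.diagonal fun c =>
        (p : WittVector p k) ^ H'.e c).updateCol i x).det := by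
      rw [← Matrix.det_transpose, ← Matrix.updateCol_transpose, Matrix.diagonal_transpose]
    rw [h6] at h1
    obtain ⟨t, ht⟩ := h1
    rw [ht, mul_left_comm] at h5
    exact ⟨t, (mul_left_cancel₀ (pow_ne_zero _ hp) h5).symm⟩
  choose t ht using key
  choose s hs using fun i => (WittVector.frobenius_bijective p k).surjective (t i)
  refine ⟨∑ i, s i • H'.v i, ?_⟩
  rw [map_sum, ← H'.w.sum_repr (ρ (C.F z))]
  refine Finset.sum_congr rfl fun i _ => ?_
  change _ = x i • _
  rw [LinearMap.map_smulₛₗ, H'.h, hs, ht, smul_smul, mul_comm]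

/-- The new retraction is `F⁻¹ ρ F`. It is linear because the twists by `σ` and `σ⁻¹` cancel, and it
fixes `S` because `ρ` fixes `F(S)`. -/
theorem HodgeBases.exists_retraction_step {C : FCrystal p k M} {ι κ : Type*} [Fintype ι]
    [Fintype κ] (H : HodgeBases C ι) {S : Submodule (WittVector p k) M}
    {hS : ∀ x ∈ S, C.F x ∈ S} (H' : HodgeBases (C.sub S hS) κ)
    (hB : ∀ f : κ → ι, Function.Injective f → ∑ i, H'.e i ≤ ∑ i, H.e (f i))
    {ρ : M →ₗ[WittVector p k] S} (hρ : ∀ x : S, ρ x = x) :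
    ∃ ρ' : M →ₗ[WittVector p k] S, (∀ x : S, ρ' x = x) ∧
      ∀ z, (C.sub S hS).F (ρ' z) = ρ (C.F z) := by
  choose y hy using H.exists_frob_eq_retraction H' hB hρ
  refine ⟨⟨⟨y, fun a b => (C.sub S hS).injective ?_⟩, fun r a => (C.sub S hS).injective ?_⟩,
    fun x => (C.sub S hS).injective ?_, hy⟩
  · simp only [hy, map_add]
  · simp only [hy, LinearMap.map_smulₛₗ, map_smul, RingHom.id_apply]
  · change (C.sub S hS).F (y x) = _
    rw [hy]
    exact hρ ((C.sub S hS).F x)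

theorem HodgeBases.exists_retraction_iterate {C : FCrystal p k M} {ι κ : Type*} [Fintype ι]
    [Fintype κ] (H : HodgeBases C ι) {S : Submodule (WittVector p k) M}
    {hS : ∀ x ∈ S, C.F x ∈ S} (H' : HodgeBases (C.sub S hS) κ)
    (hB : ∀ f : κ → ι, Function.Injective f → ∑ i, H'.e i ≤ ∑ i, H.e (f i))
    {ρ : M →ₗ[WittVector p k] S} (hρ : ∀ x : S, ρ x = x) (j : ℕ) :
    ∃ ρ' : M →ₗ[WittVector p k] S, (∀ x : S, ρ' x = x) ∧
      ∀ z, C.F^[j] (ρ' z : M) = ρ (C.F^[j] z) := by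
  induction j with
  | zero => exact ⟨ρ, hρ, fun z => rfl⟩
  | succ j ih =>
    obtain ⟨ρ₁, h₁, h₂⟩ := ih
    obtain ⟨ρ₂, h₃, h₄⟩ := H.exists_retraction_step H' hB h₁
    refine ⟨ρ₂, h₃, fun z => ?_⟩
    rw [Function.iterate_succ_apply, Function.iterate_succ_apply, ← h₂, ← h₄, C.sub_apply]

/-- The image of `f` is a submodule of a free module over a principal ideal domain, hence
projective, so `M` splits over the kernel. -/
theorem exists_retraction_ker [Module.Free (WittVector p k) M] [Module.Finite (WittVector p k) M]
    (f : M →ₗ[WittVector p k] M) :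
    ∃ ρ : M →ₗ[WittVector p k] LinearMap.ker f, ∀ x : LinearMap.ker f, ρ x = x := by
  obtain ⟨s, hs⟩ := Module.projective_lifting_property f.rangeRestrict LinearMap.id
    f.surjective_rangeRestrict
  have hs' : ∀ y, f (s y) = y := fun y => congrArg Subtype.val (LinearMap.congr_fun hs y)
  refine ⟨(LinearMap.id - s ∘ₗ f.rangeRestrict).codRestrict _ fun x => ?_, fun x => ?_⟩
  swap
  · rw [LinearMap.mem_ker]
    simp [hs']
  · apply Subtype.ext
    have hx : f.rangeRestrict x = 0 := Subtype.ext x.2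
    simp [hx]

namespace SlopeDecomposition

variable {C : FCrystal p k M} (d : SlopeDecomposition C)

/-- A retraction approximates the projection to the part of small slopes after conjugation by a
high power of the Frobenius. -/
theorem exists_isInt_retraction_sub_proj {ι : Type*} [Fintype ι] (l₀ : ℚ)
    (u : Module.Basis ι (WittVector p k) M)
    {ρ : IsoSpace p k M →ₗ[KBar p k] IsoSpace p k M}
    (hρ : ∀ x, ρ (d.proj (· ≤ l₀) x) = d.proj (· ≤ l₀) x) :
    ∃ j : ℕ, ∀ (i : ι) (y : IsoSpace p k M), d.proj (· ≤ l₀) y = y →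
      C.baseChange^[d.period * j] y = ρ (C.baseChange^[d.period * j] (1 ⊗ₜ u i)) →
      ∀ i', IsInt 0 ((u.baseChange (KBar p k)).repr
        (y - d.proj (· ≤ l₀) (1 ⊗ₜ u i)) i') := by
  classical
  set P : ℚ → Prop := (· ≤ l₀) with hP
  let z := d.basis
  let R : d.Idx → d.Idx → KBar p k := fun b b' => z.repr (ρ (z b)) b'
  obtain ⟨c₁, hc₁⟩ := exists_isInt_finite
    fun ib : ι × d.Idx => z.repr ((1 : KBar p k) ⊗ₜ[WittVector p k] u ib.1) ib.2
  obtain ⟨c₂, hc₂⟩ := exists_isInt_finite fun bb : d.Idx × d.Idx => R bb.1 bb.2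
  obtain ⟨c₃, hc₃⟩ := exists_isInt_finite
    fun ib : ι × d.Idx => (u.baseChange (KBar p k)).repr (z ib.2) ib.1
  -- Each application of `F⁻ᵖᵉʳⁱᵒᵈ ρ Fᵖᵉʳⁱᵒᵈ`-conjugation gains a factor `p`. The terms `c₁`, `c₂`,
  -- `c₃` pay for the denominators of the `u i` in the eigenbasis, of `ρ`, and of the change back to
  -- `u`.
  let j := c₁ + c₂ + c₃
  refine ⟨j, fun i y hy hF => ?_⟩
  set x : IsoSpace p k M := (1 : KBar p k) ⊗ₜ[WittVector p k] u i with hx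
  set D := y - d.proj P x with hD
  have hcomm : ∀ (t : ℕ) (x : IsoSpace p k M),
      C.baseChange^[t] (d.proj P x) = d.proj P (C.baseChange^[t] x) := fun t x =>
    (FCrystal.iterate_baseChange_map (j := d.proj P) (d.proj_baseChange P) t x).symm
  have hit_sub : ∀ (t : ℕ) (a b : IsoSpace p k M),
      C.baseChange^[t] (a - b) = C.baseChange^[t] a - C.baseChange^[t] b := by
    intro t
    induction t with
    | zero => intro a b; rfl
    | succ t ih => intro a b; simp only [Function.iterate_succ_apply, map_sub, ih]
  -- As `ρ` fixes the small-slope part, the error only sees components of slope greater than `l₀`.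
  have hDF : C.baseChange^[d.period * j] D =
      ∑ b, (if P (d.slope b.1) then 0 else
        (kBarFrob p k)^[d.period * j] (z.repr x b) * (p : KBar p k) ^ (j * d.expo b)) • ρ (z b) := by
    rw [hD, hit_sub, hF, hcomm]
    have h1 : ∀ v, ρ v - d.proj P v = ρ (v - d.proj P v) := fun v => by rw [map_sub, hρ]
    rw [h1, ← z.sum_repr (C.baseChange^[d.period * j] x - _), map_sum]
    refine Finset.sum_congr rfl fun b _ => ?_
    rw [map_smul, map_sub, Finsupp.sub_apply, d.repr_proj, d.repr_iterate]
    split_ifs <;> simp [z]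
  have hDb : ∀ b, IsInt c₃ (z.repr D b) := by
    intro b
    by_cases hb : P (d.slope b.1)
    · have h1 := d.repr_iterate j D b
      rw [hDF, map_sum, Finsupp.finsetSum_apply] at h1
      have h2 : IsInt (j * (d.expo b + 1) - c₁ - c₂)
          (∑ b', d.basis.repr ((if P (d.slope b'.1) then 0 else
            (kBarFrob p k)^[d.period * j] (z.repr x b') * (p : KBar p k) ^ (j * d.expo b')) •
              ρ (z b')) b) := by
        refine IsInt.sum fun b' _ => ?_
        rw [map_smul, Finsupp.smul_apply, smul_eq_mul]
        split_ifs with hb'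
        · rw [zero_mul]; exact IsInt.zero _
        -- The exponents are integers, so a strict inequality of slopes is a gap of at least one;
        -- over `j` periods it yields the factor `p ^ j`.
        · have h3 : d.expo b + 1 ≤ d.expo b' := by
            have h4 : d.slope b.1 < d.slope b'.1 := lt_of_le_of_lt hb (not_le.mp hb')
            have h5 : (d.expo b : ℚ) < d.expo b' := by
              rw [expo_eq, expo_eq]
              exact mul_lt_mul_of_pos_right h4 (by exact_mod_cast d.period_pos)
            exact_mod_cast h5
          have h6 := (((IsInt.iterate_iff (d.period * j)).mpr (hc₁ (i, b'))).mul
            (isInt_zpow (j * d.expo b'))).mul (hc₂ (b', b))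
          refine h6.mono ?_
          have h7 : (j : ℤ) * (d.expo b + 1) ≤ j * d.expo b' :=
            mul_le_mul_of_nonneg_left h3 (Int.natCast_nonneg j)
          linarith
      rw [h1] at h2
      have h3 := h2.mul (isInt_zpow (-(j * d.expo b)))
      rw [mul_assoc, ← zpow_add₀ kBar_p_ne_zero, add_neg_cancel, zpow_zero, mul_one,
        IsInt.iterate_iff] at h3
      refine h3.mono ?_
      simp only [j]
      push_cast
      linarith
    · have : z.repr D b = 0 := by
        rw [hD, ← hy, ← map_sub, d.repr_proj, if_neg hb]
      rw [this]
      exact IsInt.zero _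
  intro i'
  rw [← z.sum_repr D, map_sum, Finsupp.finsetSum_apply]
  refine IsInt.sum fun b _ => ?_
  rw [map_smul, Finsupp.smul_apply, smul_eq_mul]
  exact ((hDb b).mul (hc₃ (i', b))).mono (by linarith)

/-- The Newton–Hodge decomposition: if the Hodge polygon touches the Newton polygon at the end
point of the part of slopes at most `l₀`, the projection to this part is defined over `W(k)`. -/
theorem exists_integral_proj {ι : Type*} [Fintype ι] (H : HodgeBases C ι) (l₀ : ℚ)
    (hB : ∀ f : Fin (Multiset.card (d.slopes.filter (· ≤ l₀))) → ι, Function.Injective f →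
      (d.slopes.filter (· ≤ l₀)).sum ≤ ((∑ i, H.e (f i) : ℕ) : ℚ)) :
    ∃ g : M →ₗ[WittVector p k] M, ∀ z, g.baseChange (KBar p k) z = d.proj (· ≤ l₀) z := by
  have := C.free
  have := C.finite
  set P : ℚ → Prop := (· ≤ l₀) with hP
  let _ : DecidablePred P := fun x => inferInstanceAs (Decidable (x ≤ l₀))
  have hp := kBar_p_ne_zero (p := p) (k := k)
  obtain ⟨c, g, hg⟩ := d.exists_integral_multiple P
  have hg1 : ∀ m : M, (1 : KBar p k) ⊗ₜ[WittVector p k] g m =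
      (p : KBar p k) ^ c • d.proj P (1 ⊗ₜ m) := fun m => by rw [← hg, LinearMap.baseChange_tmul]
  have hpow : ∀ m : M, (1 : KBar p k) ⊗ₜ[WittVector p k] ((p : WittVector p k) ^ c • m) =
      (p : KBar p k) ^ c • (1 ⊗ₜ m) := fun m => by
    rw [← TensorProduct.smul_tmul, Algebra.smul_def, map_pow, map_natCast, TensorProduct.smul_tmul',
      smul_eq_mul]
  have hgg : ∀ m, g (g m) = (p : WittVector p k) ^ c • g m := fun m => by
    apply C.one_tmul_injective
    simp only [hpow, hg1, map_smul, proj_comp, and_self]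
  have hgF : ∀ m, g (C.F m) = C.F (g m) := fun m => by
    apply C.one_tmul_injective
    have h1 := C.baseChange_tmul 1 m
    have h2 := C.baseChange_tmul 1 (g m)
    rw [map_one] at h1 h2
    simp only [hg1, ← h1, ← h2, proj_baseChange, LinearMap.map_smulₛₗ, map_pow, map_natCast]
  -- Since `g` is `p ^ c` times the projection, the kernel of `f` is the intersection of `M` with
  -- the small-slope part.
  let f : M →ₗ[WittVector p k] M := g - (p : WittVector p k) ^ c • LinearMap.id
  let S := LinearMap.ker f
  have hmem : ∀ x, x ∈ S ↔ g x = (p : WittVector p k) ^ c • x := fun x => by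
    simp [S, f, sub_eq_zero]
  have hS : ∀ x ∈ S, C.F x ∈ S := fun x hx => by
    rw [hmem] at hx ⊢
    rw [hgF, hx, LinearMap.map_smulₛₗ, map_pow, map_natCast]
  obtain ⟨ρ, hρ⟩ := exists_retraction_ker f
  let gS : M →ₗ[WittVector p k] S := g.codRestrict S fun m => (hmem _).mpr (hgg m)
  obtain ⟨d', hd'⟩ := d.exists_of_retract (E := C.sub S hS) P (S.subtype.baseChange (KBar p k))
    (((p : KBar p k) ^ c)⁻¹ • gS.baseChange (KBar p k))
    (fun x => by
      rw [LinearMap.smul_apply, ← LinearMap.comp_apply, ← LinearMap.baseChange_comp]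
      have h1 : gS ∘ₗ S.subtype = (p : WittVector p k) ^ c • LinearMap.id := by
        ext1 x
        exact Subtype.ext ((hmem _).mp x.2)
      rw [h1, LinearMap.baseChange_smul, LinearMap.baseChange_id, LinearMap.smul_apply,
        LinearMap.id_apply, algebra_compatible_smul (KBar p k) ((p : WittVector p k) ^ c), map_pow,
        map_natCast,
        inv_smul_smul₀ (pow_ne_zero _ hp)])
    (fun z => by
      rw [LinearMap.smul_apply, map_smul, ← LinearMap.comp_apply, ← LinearMap.baseChange_comp]
      have h1 : S.subtype ∘ₗ gS = g := rfl
      rw [h1, hg, inv_smul_smul₀ (pow_ne_zero _ hp)])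
    (FCrystal.baseChange_map _ fun x => rfl)
  obtain ⟨H'⟩ := HodgeBases.exists_of_basis (C.sub S hS)
    (Module.Free.chooseBasis (WittVector p k) S)
  obtain ⟨hsum, hcard⟩ := H'.sum_eq_sum_slopes d'
  -- Equality of end points for `S` turns the bound on its Newton slopes into one on its Hodge
  -- slopes.
  have hB' : ∀ f : Module.Free.ChooseBasisIndex (WittVector p k) S → ι, Function.Injective f → ∑ i, H'.e i ≤ ∑ i, H.e (f i) := by
    intro f hf
    let e : Module.Free.ChooseBasisIndex (WittVector p k) S ≃
        Fin (Multiset.card (d.slopes.filter (· ≤ l₀))) := Fintype.equivFinOfCardEq (hcard.symm.trans (congrArg _ hd'))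
    have h1 := hB (f ∘ e.symm) (hf.comp e.symm.injective)
    have h2 : ∑ i, H.e ((f ∘ e.symm) i) = ∑ i, H.e (f i) := e.symm.sum_comp (fun i => H.e (f i))
    rw [h2, show d.slopes.filter (· ≤ l₀) = d'.slopes from hd'.symm, ← hsum] at h1
    exact_mod_cast h1
  let u := Module.Free.chooseBasis (WittVector p k) M
  let ρ' := (S.subtype ∘ₗ ρ).baseChange (KBar p k)
  have hρS : ∀ x ∈ S, ((ρ x : S) : M) = x := fun x hx => congrArg Subtype.val (hρ ⟨x, hx⟩)
  have hSproj : ∀ x ∈ S, d.proj P ((1 : KBar p k) ⊗ₜ[WittVector p k] x) = 1 ⊗ₜ x := by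
    intro x hx
    apply smul_right_injective _ (pow_ne_zero c hp)
    simp only
    rw [← hg1, (hmem x).mp hx, hpow]
  have hρ1 : ∀ x, ρ' (d.proj P x) = d.proj P x := by
    intro x
    apply smul_right_injective _ (pow_ne_zero c hp)
    simp only
    rw [← map_smul, ← hg, ← LinearMap.comp_apply, ← LinearMap.baseChange_comp]
    congr 2
    ext1 m
    exact hρS _ ((hmem _).mpr (hgg m))
  obtain ⟨j, hj⟩ := d.exists_isInt_retraction_sub_proj l₀ u hρ1
  obtain ⟨ρ₁, -, hρ₁⟩ := H.exists_retraction_iterate H' hB' hρ (d.period * j)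
  -- The integral retraction `F⁻ʲ ρ Fʲ` differs from the projection by an integral error, so the
  -- projection of each `u i` is integral.
  have hdvd : ∀ i i', (p : WittVector p k) ^ c ∣ u.repr (g (u i)) i' := by
    intro i i'
    have h1 := hj i (1 ⊗ₜ (ρ₁ (u i) : M)) (hSproj _ (ρ₁ (u i)).2) (by
      rw [C.iterate_baseChange_one_tmul, C.iterate_baseChange_one_tmul, hρ₁]
      rfl) i'
    have h2 := (isInt_zpow (p := p) (k := k) c).mul h1
    have h3 : (p : KBar p k) ^ (c : ℤ) * ((u.baseChange (KBar p k)).repr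
        ((1 : KBar p k) ⊗ₜ[WittVector p k] (ρ₁ (u i) : M) - d.proj P (1 ⊗ₜ u i))) i' =
        algebraMap (WittVector p k) (KBar p k)
          ((p : WittVector p k) ^ c * u.repr (ρ₁ (u i) : M) i' - u.repr (g (u i)) i') := by
      rw [zpow_natCast, ← smul_eq_mul, ← Finsupp.smul_apply, ← map_smul, smul_sub, ← hg1, ← hpow,
        ← TensorProduct.tmul_sub, Module.Basis.baseChange_repr_tmul, Algebra.smul_def, mul_one,
        map_sub, map_smul, Finsupp.sub_apply, Finsupp.smul_apply, smul_eq_mul]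
    rw [h3, add_zero, isInt_algebraMap_iff] at h2
    exact (dvd_sub_right (dvd_mul_right _ _)).mp h2
  choose w hw using hdvd
  let g' : M →ₗ[WittVector p k] M := u.constr ℕ fun i => ∑ i', w i i' • u i'
  have hg' : g = (p : WittVector p k) ^ c • g' := by
    apply u.ext
    intro i
    rw [LinearMap.smul_apply, Module.Basis.constr_basis, Finset.smul_sum,
      ← u.sum_repr (g (u i))]
    exact Finset.sum_congr rfl fun i' _ => by rw [hw, smul_smul]
  refine ⟨g', fun z => ?_⟩
  apply smul_right_injective _ (pow_ne_zero c hp)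
  simp only
  rw [← hg, hg', LinearMap.baseChange_smul, LinearMap.smul_apply,
    algebra_compatible_smul (KBar p k) ((p : WittVector p k) ^ c), map_pow, map_natCast]

end SlopeDecomposition

end

/-! ### Integral slope projections. -/

section

variable {p : ℕ} [Fact p.Prime] {k : Type*} [Field k] [CharP k p] [PerfectRing k p]
variable {M : Type*} [AddCommGroup M] [Module (WittVector p k) M]

namespace SlopeDecomposition

variable {C : FCrystal p k M} (d : SlopeDecomposition C)

/-- `g` is a form over `W(k)` of the projection to the part with slopes satisfying `P`. -/
def IsForm (P : ℚ → Prop) (g : M →ₗ[WittVector p k] M) : Prop :=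
  ∀ z, g.baseChange (KBar p k) z = d.proj P z

namespace IsForm

variable {d} {P Q : ℚ → Prop} {g h : M →ₗ[WittVector p k] M}

theorem one_tmul (hg : d.IsForm P g) (m : M) :
    (1 : KBar p k) ⊗ₜ[WittVector p k] g m = d.proj P (1 ⊗ₜ m) := by
  rw [← hg, LinearMap.baseChange_tmul]

theorem idem (hg : d.IsForm P g) (m : M) : g (g m) = g m := by
  apply C.one_tmul_injective
  simp only [hg.one_tmul, proj_comp, and_self]

theorem frob (hg : d.IsForm P g) (m : M) : g (C.F m) = C.F (g m) := by
  apply C.one_tmul_injective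
  have h1 := C.baseChange_tmul 1 m
  have h2 := C.baseChange_tmul 1 (g m)
  rw [map_one] at h1 h2
  simp only [hg.one_tmul, ← h1, ← h2, proj_baseChange]

theorem unique {h : M →ₗ[WittVector p k] M} (hg : d.IsForm P g) (hh : d.IsForm P h) : g = h := by
  ext m
  apply C.one_tmul_injective
  simp only [hg.one_tmul, hh.one_tmul]

theorem compl (hg : d.IsForm P g) : d.IsForm (fun x => ¬ P x) (LinearMap.id - g) := fun z => by
  rw [LinearMap.baseChange_sub, LinearMap.baseChange_id, LinearMap.sub_apply, hg z,
    LinearMap.id_apply, sub_eq_iff_eq_add', proj_add_proj]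

theorem comp (hg : d.IsForm P g) (hh : d.IsForm Q h) :
    d.IsForm (fun x => P x ∧ Q x) (g ∘ₗ h) := fun z => by
  rw [LinearMap.baseChange_comp, LinearMap.comp_apply, hg, hh, proj_comp]

theorem congr (hg : d.IsForm P g) (hPQ : ∀ x, P x ↔ Q x) : d.IsForm Q g := by
  rwa [show Q = P from funext fun x => propext (hPQ x).symm]

theorem mem_range (hg : d.IsForm P g) {x : M} : x ∈ LinearMap.range g ↔ g x = x :=
  ⟨fun ⟨y, hy⟩ => by rw [← hy, hg.idem], fun hx => ⟨x, hx⟩⟩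

theorem stable (hg : d.IsForm P g) : ∀ x ∈ LinearMap.range g, C.F x ∈ LinearMap.range g := by
  intro x hx
  rw [hg.mem_range] at hx ⊢
  rw [hg.frob, hx]

theorem isCompl (hg : d.IsForm P g) (hh : d.IsForm (fun x => ¬ P x) h) :
    IsCompl (LinearMap.range g) (LinearMap.range h) := by
  have hgh : ∀ x, g x + h x = x := by
    intro x
    apply C.one_tmul_injective
    simp only [TensorProduct.tmul_add, hg.one_tmul, hh.one_tmul, proj_add_proj]
  rw [isCompl_iff, Submodule.disjoint_def, codisjoint_iff, eq_top_iff]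
  refine ⟨fun x hx hx' => ?_, fun x _ => ?_⟩
  · rw [hg.mem_range] at hx
    rw [hh.mem_range] at hx'
    simpa [hx, hx'] using hgh x
  · rw [← hgh x]
    exact Submodule.add_mem_sup ⟨x, rfl⟩ ⟨x, rfl⟩

theorem exists_slopes [DecidablePred P] (hg : d.IsForm P g) :
    ∃ d' : SlopeDecomposition (C.sub _ hg.stable), d'.slopes = d.slopes.filter P := by
  refine d.exists_of_retract P ((LinearMap.range g).subtype.baseChange (KBar p k))
    (g.rangeRestrict.baseChange (KBar p k)) (fun x => ?_) (fun z => ?_)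
    (FCrystal.baseChange_map _ fun x => rfl)
  · rw [← LinearMap.comp_apply, ← LinearMap.baseChange_comp]
    have h1 : g.rangeRestrict ∘ₗ (LinearMap.range g).subtype = LinearMap.id := by
      ext1 x
      exact Subtype.ext (hg.mem_range.mp x.2)
    rw [h1, LinearMap.baseChange_id, LinearMap.id_apply]
  · rw [← LinearMap.comp_apply, ← LinearMap.baseChange_comp]
    exact hg z

theorem isNewtonSlopes [DecidablePred P] (hg : d.IsForm P g) {l : List ℚ}
    (hl : l.Pairwise (· ≤ ·)) (hd : (l : Multiset ℚ) = d.slopes) :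
    IsNewtonSlopes (C.sub _ hg.stable) (l.filter P) := by
  rw [isNewtonSlopes_iff]
  obtain ⟨d', hd'⟩ := hg.exists_slopes
  exact ⟨hl.filter _, d', by rw [hd', ← hd, Multiset.filter_coe]⟩

end IsForm

/-- A stable submodule all of whose slopes satisfy `P` lies in the part with slopes satisfying
`P`. -/
theorem proj_of_subcrystal {S : Submodule (WittVector p k) M} {E : FCrystal p k S}
    (hE : IsSubcrystal C E) (d' : SlopeDecomposition E) {P : ℚ → Prop}
    (hP : ∀ x ∈ d'.slopes, P x) (x : S) :
    d.proj P ((1 : KBar p k) ⊗ₜ[WittVector p k] (x : M)) = 1 ⊗ₜ (x : M) := by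
  have hj : ∀ z, S.subtype.baseChange (KBar p k) (E.baseChange z) =
      C.baseChange (S.subtype.baseChange (KBar p k) z) := FCrystal.baseChange_map _ hE
  have h1 : ∀ z, d.proj P (S.subtype.baseChange (KBar p k) z) =
      S.subtype.baseChange (KBar p k) z := by
    intro z
    rw [← d'.basis.sum_repr z, map_sum, map_sum]
    refine Finset.sum_congr rfl fun b _ => ?_
    rw [map_smul, map_smul]
    congr 1
    refine d.proj_eq_self_of_iterate d'.period_pos (m := d'.expo b) ?_ ?_
    · rw [← FCrystal.iterate_baseChange_map hj, d'.iterate_basis, map_smul]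
    · rw [expo_div_period]
      refine hP _ ?_
      rw [← map_slope_univ]
      exact Multiset.mem_map_of_mem _ (Finset.mem_univ b)
  exact h1 (1 ⊗ₜ x)

theorem IsForm.le_range {P : ℚ → Prop} {g : M →ₗ[WittVector p k] M} {d : SlopeDecomposition C}
    (hg : d.IsForm P g) {S : Submodule (WittVector p k) M} {E : FCrystal p k S}
    (hE : IsSubcrystal C E) (d' : SlopeDecomposition E) (hP : ∀ x ∈ d'.slopes, P x) :
    S ≤ LinearMap.range g := by
  intro x hx
  rw [hg.mem_range]
  apply C.one_tmul_injective
  simp only [hg.one_tmul]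
  exact d.proj_of_subcrystal hE d' hP ⟨x, hx⟩

end SlopeDecomposition

/-! ### Duality of slopes and restriction of self-dual structures. -/

namespace SelfDualFCrystal

variable (D : SelfDualFCrystal p k M)

/-- Eliminates `F_{M^*}`: the slope arguments use the self-dual structure only through this identity
and the perfectness of `Ψ`. -/
theorem Ψ_frob (x y : M) : D.Ψ (D.F x) (D.F y) = D.c * wittFrob p k (D.Ψ x y) := by
  have h1 := LinearMap.congr_fun (D.transpose_dual (D.Ψ x)) y
  rw [LinearMap.smul_apply, smul_eq_mul] at h1
  have h2 : (WittVector.frobeniusEquiv p k) (transposeMap D.F (D.dual.F (D.Ψ x)) y) =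
      D.dual.F (D.Ψ x) (D.F y) := (WittVector.frobeniusEquiv p k).apply_symm_apply _
  rw [D.Ψ_comm, ← h2, h1, map_mul, RingEquiv.apply_symm_apply]
  rfl

/-- The valuation of the constant `c`. -/
def weight : ℕ := (WittVector.exists_eq_pow_p_mul' D.c D.c_ne_zero).choose

theorem exists_c_eq : ∃ u : (WittVector p k)ˣ, D.c = (p : WittVector p k) ^ D.weight * u :=
  (WittVector.exists_eq_pow_p_mul' D.c D.c_ne_zero).choose_spec

/-- The extension of the form `Ψ` to `K' ⊗ M`. -/
def form : LinearMap.BilinForm (KBar p k) (IsoSpace p k M) :=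
  LinearMap.BilinForm.baseChange (KBar p k) (D.Ψ.toLinearMap : LinearMap.BilinForm (WittVector p k) M)

theorem form_tmul (a b : KBar p k) (x y : M) :
    D.form (a ⊗ₜ x) (b ⊗ₜ y) = algebraMap (WittVector p k) (KBar p k) (D.Ψ x y) * (a * b) := by
  rw [form, LinearMap.BilinForm.baseChange_tmul, Algebra.smul_def]
  rfl

theorem form_frob (x y : IsoSpace p k M) :
    D.form (D.baseChange x) (D.baseChange y) =
      algebraMap (WittVector p k) (KBar p k) D.c * kBarFrob p k (D.form x y) := by
  induction x using TensorProduct.induction_on with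
  | zero => simp
  | add x x' hx hx' => simp only [map_add, LinearMap.add_apply, hx, hx', mul_add]
  | tmul a m =>
    induction y using TensorProduct.induction_on with
    | zero => simp
    | add y y' hy hy' => simp only [map_add, hy, hy', mul_add]
    | tmul b m' =>
      rw [FCrystal.baseChange_tmul, FCrystal.baseChange_tmul, form_tmul, form_tmul, Ψ_frob, map_mul,
        map_mul, map_mul, kBarFrob_algebraMap, mul_assoc]

theorem valK_form_iterate {x y : IsoSpace p k M} (hxy : D.form x y ≠ 0) (t : ℕ) :
    D.form (D.baseChange^[t] x) (D.baseChange^[t] y) ≠ 0 ∧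
      valK (D.form (D.baseChange^[t] x) (D.baseChange^[t] y)) =
        t * D.weight + valK (D.form x y) := by
  have hc : algebraMap (WittVector p k) (KBar p k) D.c ≠ 0 :=
    (map_ne_zero_iff _ algebraMap_kBar_injective).mpr D.c_ne_zero
  have hc' : valK (algebraMap (WittVector p k) (KBar p k) D.c) = D.weight := by
    obtain ⟨u, hu⟩ := D.exists_c_eq
    conv_lhs => rw [hu]
    exact valK_algebraMap_pow_mul_unit _ _
  induction t with
  | zero => simpa using hxy
  | succ t ih =>
    simp only [Function.iterate_succ_apply']
    have h1 := (map_ne_zero (kBarFrob p k)).mpr ih.1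
    rw [form_frob, valK_mul hc h1, valK_kBarFrob, hc', ih.2]
    refine ⟨mul_ne_zero hc h1, ?_⟩
    push_cast
    ring

/-- Under `F ^ period` the valuation of a nonzero pairing grows by `expo b + expo b'` and also by
`period * weight`. -/
theorem slope_add_slope (d : SlopeDecomposition D.toFCrystal) {b b' : d.Idx}
    (h : D.form (d.basis b) (d.basis b') ≠ 0) : d.slope b.1 + d.slope b'.1 = D.weight := by
  have h1 := (D.valK_form_iterate h d.period).2
  rw [d.iterate_basis, d.iterate_basis, map_smul, map_smul, LinearMap.smul_apply, smul_eq_mul,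
    smul_eq_mul, valK_mul (zpow_ne_zero _ kBar_p_ne_zero)
      (mul_ne_zero (zpow_ne_zero _ kBar_p_ne_zero) h),
    valK_mul (zpow_ne_zero _ kBar_p_ne_zero) h, valK_zpow, valK_zpow] at h1
  have h2 : (d.expo b : ℚ) + d.expo b' = d.period * D.weight := by
    have : d.expo b + d.expo b' = d.period * D.weight := by linarith
    exact_mod_cast this
  have h3 : (d.period : ℚ) ≠ 0 := by exact_mod_cast d.period_pos.ne'
  rw [← d.expo_div_period, ← d.expo_div_period, ← add_div, h2, mul_div_cancel_left₀ _ h3]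

/-- Only basis pairs whose slopes add up to the weight contribute. Symmetry of `Ψ` plays no role:
the reflection is an involution, so projections move across the form in both directions. -/
theorem form_proj (d : SlopeDecomposition D.toFCrystal) (P : ℚ → Prop) (x y : IsoSpace p k M) :
    D.form (d.proj P x) y = D.form x (d.proj (fun t => P (D.weight - t)) y) := by
  classical
  rw [← d.basis.sum_repr x, ← d.basis.sum_repr y]
  simp only [map_sum, map_smul, LinearMap.sum_apply, LinearMap.smul_apply, d.proj_basis]
  refine Finset.sum_congr rfl fun b' _ => ?_
  congr 1
  refine Finset.sum_congr rfl fun b _ => ?_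
  congr 1
  by_cases h : D.form (d.basis b) (d.basis b') = 0
  · split_ifs <;> simp [h]
  · have h1 := D.slope_add_slope d h
    have h2 : (D.weight : ℚ) - d.slope b'.1 = d.slope b.1 := by linarith
    rw [h2]
    split_ifs <;> simp

theorem form_nondegenerate {x : IsoSpace p k M} (hx : ∀ y, D.form x y = 0) : x = 0 := by
  classical
  have := D.free
  have := D.finite
  let w := Module.Free.chooseBasis (WittVector p k) M
  let v := (w.dualBasis.map D.Ψ.symm).baseChange (KBar p k)
  apply v.repr.injective
  refine Finsupp.ext fun i => ?_
  have h1 := hx (1 ⊗ₜ w i)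
  rw [← v.sum_repr x] at h1
  simp only [map_sum, map_smul, LinearMap.sum_apply, LinearMap.smul_apply, v,
    Module.Basis.baseChange_apply, form_tmul, Module.Basis.map_apply, LinearEquiv.apply_symm_apply,
    Module.Basis.dualBasis_apply_self] at h1
  rw [Finset.sum_eq_single i (fun j _ hj => by simp [hj.symm]) (by simp)] at h1
  simpa using h1

/-- The Newton slopes are symmetric. -/
theorem newton_symm (d : SlopeDecomposition D.toFCrystal) :
    d.slopes.map (fun t => (D.weight : ℚ) - t) = d.slopes := by
  classical
  -- The Gram matrix is invertible, so some term of its determinant is nonzero; the corresponding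
  -- permutation matches each slope with its reflection.
  let A : Matrix d.Idx d.Idx (KBar p k) := Matrix.of fun b b' => D.form (d.basis b) (d.basis b')
  have hA : A.det ≠ 0 := by
    intro h
    obtain ⟨v, hv, hv0⟩ := Matrix.exists_vecMul_eq_zero_iff.mpr h
    apply hv
    have h1 : ∑ b, v b • d.basis b = 0 := by
      apply D.form_nondegenerate
      intro y
      rw [← d.basis.sum_repr y, map_sum]
      refine Finset.sum_eq_zero fun b' _ => ?_
      have h2 := congrFun hv0 b'
      simp only [Matrix.vecMul, dotProduct, A, Matrix.of_apply, Pi.zero_apply] at h2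
      rw [map_smul, map_sum, LinearMap.sum_apply]
      simp only [map_smul, LinearMap.smul_apply, smul_eq_mul]
      rw [h2, mul_zero]
    ext1 b
    have h2 := d.basis.repr_sum_self v
    rw [h1] at h2
    simpa using (congrFun h2 b).symm
  have hτ : ∃ τ : Equiv.Perm d.Idx, ∀ b, A (τ b) b ≠ 0 := by
    by_contra! h
    apply hA
    rw [Matrix.det_apply']
    refine Finset.sum_eq_zero fun τ _ => ?_
    obtain ⟨b, hb⟩ := h τ
    rw [show ∏ i, A (τ i) i = 0 from Finset.prod_eq_zero (Finset.mem_univ b) hb, mul_zero]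
  obtain ⟨τ, hτ⟩ := hτ
  rw [← d.map_slope_univ, Multiset.map_map]
  have h2 : (Finset.univ : Finset d.Idx).val = Multiset.map τ Finset.univ.val := by
    conv_lhs => rw [← Finset.map_univ_equiv τ]
    rfl
  conv_rhs => rw [h2, Multiset.map_map]
  refine Multiset.map_congr rfl fun b _ => ?_
  have := D.slope_add_slope d (hτ b)
  simp only [Function.comp_apply]
  linarith

/-- The adjoint of a slope projection defined over `W(k)`. -/
theorem exists_adjoint {d : SlopeDecomposition D.toFCrystal} {P : ℚ → Prop}
    {g : M →ₗ[WittVector p k] M} (hg : d.IsForm P g) :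
    ∃ h, d.IsForm (fun t => P (D.weight - t)) h := by
  -- The transpose of `g` carried back by `Ψ` is integral because `Ψ` is an isomorphism over `W(k)`;
  -- nondegeneracy identifies it with the reflected projection.
  refine ⟨D.Ψ.symm.toLinearMap ∘ₗ g.dualMap ∘ₗ D.Ψ.toLinearMap, fun z => ?_⟩
  set h := D.Ψ.symm.toLinearMap ∘ₗ g.dualMap ∘ₗ D.Ψ.toLinearMap
  have hh : ∀ x y, D.Ψ (h x) y = D.Ψ x (g y) := fun x y => by simp [h]
  have hform : ∀ x y, D.form (h.baseChange (KBar p k) x) y =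
      D.form x (g.baseChange (KBar p k) y) := by
    intro x y
    induction x using TensorProduct.induction_on with
    | zero => simp
    | add x x' hx hx' => simp only [map_add, LinearMap.add_apply, hx, hx']
    | tmul a m =>
      induction y using TensorProduct.induction_on with
      | zero => simp
      | add y y' hy hy' => simp only [map_add, hy, hy']
      | tmul b m' => rw [LinearMap.baseChange_tmul, LinearMap.baseChange_tmul, form_tmul, form_tmul, hh]
  rw [← sub_eq_zero]
  apply D.form_nondegenerate
  intro y
  rw [map_sub, LinearMap.sub_apply, hform, hg, form_proj]
  simp

theorem Ψ_isForm {d : SlopeDecomposition D.toFCrystal} {P : ℚ → Prop}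
    {g h : M →ₗ[WittVector p k] M} (hg : d.IsForm P g)
    (hh : d.IsForm (fun t => P (D.weight - t)) h) (x y : M) : D.Ψ (g x) y = D.Ψ x (h y) := by
  apply algebraMap_kBar_injective
  have h1 := D.form_proj d P (1 ⊗ₜ x) (1 ⊗ₜ y)
  rw [← hg.one_tmul, ← hh.one_tmul, form_tmul, form_tmul] at h1
  simpa using h1

section Restrict

variable {D} {g h : M →ₗ[WittVector p k] M}

theorem coe_rangeRestrict (g : M →ₗ[WittVector p k] M) (x : M) : (g.rangeRestrict x : M) = g x :=
  rfl

/-- The perfect pairing between the images of two adjoint idempotents. -/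
def rangePairing (hg : ∀ x, g (g x) = g x) (hh : ∀ x, h (h x) = h x)
    (hΨ : ∀ x y, D.Ψ (g x) y = D.Ψ x (h y)) :
    LinearMap.range g ≃ₗ[WittVector p k] Module.Dual (WittVector p k) (LinearMap.range h) :=
  LinearEquiv.ofLinearMap
    ((LinearMap.range h).subtype.dualMap ∘ₗ D.Ψ.toLinearMap ∘ₗ (LinearMap.range g).subtype)
    -- The inverse extends a functional to `M` through `h`, represents it by `Ψ`, and projects the
    -- representing vector by `g`.
    (g.rangeRestrict ∘ₗ D.Ψ.symm.toLinearMap ∘ₗ h.rangeRestrict.dualMap)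
    (by
      apply LinearMap.ext
      intro φ
      apply LinearMap.ext
      rintro ⟨_, y, rfl⟩
      simp only [LinearMap.comp_apply, LinearMap.dualMap_apply, LinearEquiv.coe_coe,
        Submodule.subtype_apply, coe_rangeRestrict, LinearMap.id_apply]
      rw [hΨ, LinearEquiv.apply_symm_apply, LinearMap.dualMap_apply]
      congr 1
      apply Subtype.ext
      simp [hh])
    (by
      apply LinearMap.ext
      rintro ⟨_, x, rfl⟩
      apply Subtype.ext
      simp only [LinearMap.comp_apply, LinearEquiv.coe_coe, Submodule.subtype_apply,
        coe_rangeRestrict, LinearMap.id_apply]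
      have h1 : h.rangeRestrict.dualMap ((LinearMap.range h).subtype.dualMap (D.Ψ (g x))) =
          D.Ψ (g x) := by
        apply LinearMap.ext
        intro y
        simp only [LinearMap.dualMap_apply, Submodule.subtype_apply, coe_rangeRestrict]
        rw [← hΨ, hg]
      rw [h1, LinearEquiv.symm_apply_apply, hg])

/-- The form induced on the image of a self-adjoint idempotent. -/
def rangeForm (hg : ∀ x, g (g x) = g x) (hΨ : ∀ x y, D.Ψ (g x) y = D.Ψ x (g y)) :
    LinearMap.range g ≃ₗ[WittVector p k] Module.Dual (WittVector p k) (LinearMap.range g) :=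
  rangePairing hg hg hΨ

theorem rangeForm_apply (hg : ∀ x, g (g x) = g x) (hΨ : ∀ x y, D.Ψ (g x) y = D.Ψ x (g y))
    (x y : LinearMap.range g) : rangeForm hg hΨ x y = D.Ψ x y := rfl

/-- Reduces the axiom `dual_transpose` for the restricted crystal to the one for `D`, applied to
functionals extended through `g`. -/
theorem Ψ_rangeForm_symm (hg : ∀ x, g (g x) = g x) (hΨ : ∀ x y, D.Ψ (g x) y = D.Ψ x (g y))
    (φ : Module.Dual (WittVector p k) (LinearMap.range g)) :
    D.Ψ ((rangeForm hg hΨ).symm φ : M) = φ ∘ₗ g.rangeRestrict := by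
  obtain ⟨⟨_, x, rfl⟩, rfl⟩ := (rangeForm hg hΨ).surjective φ
  rw [LinearEquiv.symm_apply_apply]
  apply LinearMap.ext
  intro y
  rw [LinearMap.comp_apply, rangeForm_apply, coe_rangeRestrict]
  rw [← hΨ, hg]

/-- The self-dual `F`-crystal on the image of a self-adjoint idempotent commuting with `F`. -/
def restrict (D : SelfDualFCrystal p k M) (hg : ∀ x, g (g x) = g x)
    (hS : ∀ x ∈ LinearMap.range g, D.F x ∈ LinearMap.range g)
    (hF : ∀ x, g (D.F x) = D.F (g x)) (hΨ : ∀ x y, D.Ψ (g x) y = D.Ψ x (g y)) :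
    SelfDualFCrystal p k (LinearMap.range g) where
  toFCrystal := D.toFCrystal.sub _ hS
  dual :=
    { free := by
        have := (D.toFCrystal.sub _ hS).free
        have := (D.toFCrystal.sub _ hS).finite
        infer_instance
      finite := by
        have := (D.toFCrystal.sub _ hS).free
        have := (D.toFCrystal.sub _ hS).finite
        infer_instance
      F :=
        -- Frobenius on the dual is transported from the submodule through the restricted form, so
        -- compatibility with `Ψ` is automatic.
        { toFun := fun φ => rangeForm hg hΨ
            ((D.toFCrystal.sub _ hS).F ((rangeForm hg hΨ).symm φ))
          map_add' := fun φ ψ => by simp only [map_add]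
          map_smul' := fun r φ => by simp only [map_smul, LinearMap.map_smulₛₗ] }
      injective := (rangeForm hg hΨ).injective.comp
        ((D.toFCrystal.sub _ hS).injective.comp (rangeForm hg hΨ).symm.injective) }
  c := D.c
  c_ne_zero := D.c_ne_zero
  dual_transpose φ := by
    apply LinearMap.ext
    intro y
    have h1 : transposeMap D.F (φ ∘ₗ g.rangeRestrict) =
        transposeMap (D.toFCrystal.sub _ hS).F φ ∘ₗ g.rangeRestrict := by
      apply LinearMap.ext
      intro m
      change (WittVector.frobeniusEquiv p k).symm (φ (g.rangeRestrict (D.F m))) =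
        (WittVector.frobeniusEquiv p k).symm (φ ((D.toFCrystal.sub _ hS).F (g.rangeRestrict m)))
      congr 2
      exact Subtype.ext (hF m)
    have h2 := D.dual_transpose (φ ∘ₗ g.rangeRestrict)
    rw [h1, ← Ψ_rangeForm_symm hg hΨ, ← D.Ψ_comm] at h2
    have h3 := LinearMap.congr_fun h2 (y : M)
    refine h3.trans ?_
    rw [LinearMap.smul_apply, LinearMap.smul_apply, LinearMap.comp_apply]
    congr 2
    obtain ⟨_, y, rfl⟩ := y
    exact Subtype.ext (hg y)
  transpose_dual φ := by
    apply LinearMap.ext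
    intro y
    obtain ⟨x, rfl⟩ := (rangeForm hg hΨ).surjective φ
    change (WittVector.frobeniusEquiv p k).symm (rangeForm hg hΨ ((D.toFCrystal.sub _ hS).F
      ((rangeForm hg hΨ).symm (rangeForm hg hΨ x))) ((D.toFCrystal.sub _ hS).F y)) = _
    rw [LinearEquiv.symm_apply_apply, rangeForm_apply, FCrystal.sub_apply, FCrystal.sub_apply,
      Ψ_frob, map_mul, LinearMap.smul_apply, smul_eq_mul, rangeForm_apply]
    congr 1
    exact (WittVector.frobeniusEquiv p k).symm_apply_apply _
  Ψ := rangeForm hg hΨ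
  Ψ_comm m := by
    change _ = rangeForm hg hΨ ((D.toFCrystal.sub _ hS).F
      ((rangeForm hg hΨ).symm (rangeForm hg hΨ m)))
    rw [LinearEquiv.symm_apply_apply]

end Restrict

end SelfDualFCrystal

end

/-! ### Sorted lists of slopes, and Hodge slopes of sums and duals. -/

section

section Lists

theorem strictMono_le {A n : ℕ} {f : Fin A → Fin n} (hf : StrictMono f) (i : Fin A) :
    (i : ℕ) ≤ f i := by
  obtain ⟨i, hi⟩ := i
  induction i with
  | zero => exact Nat.zero_le _
  | succ i ih =>
    have h1 := ih (by omega)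
    have h2 : f ⟨i, by omega⟩ < f ⟨i + 1, hi⟩ := hf (by simp)
    have h3 : (f ⟨i, by omega⟩ : ℕ) < f ⟨i + 1, hi⟩ := h2
    simp only at h1 ⊢
    omega

theorem getElem_le_getElem {α : Type*} [Preorder α] {a : List α} (ha : a.Pairwise (· ≤ ·))
    {i j : ℕ} (hj : j < a.length) (hij : i ≤ j) : a[i]'(by omega) ≤ a[j] := by
  rcases hij.eq_or_lt with rfl | h
  · exact le_rfl
  · exact List.pairwise_iff_getElem.mp ha i j _ _ h

theorem sum_take_eq_sum_fin {a : List ℕ} {A : ℕ} (hA : A ≤ a.length) :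
    (a.take A).sum = ∑ i : Fin A, a[(i : ℕ)]'(by omega) := by
  have h : a.take A = List.ofFn fun i : Fin A => a[(i : ℕ)]'(by omega) := by
    apply List.ext_getElem
    · simp [hA]
    · intro i h1 h2
      simp
  conv_lhs => rw [h, List.sum_ofFn]

/-- Enumerating the image of `f` increasingly, the `i`-th index is at least `i`, so the first `A`
entries are termwise minimal. -/
theorem sum_take_le_sum {a : List ℕ} (ha : a.Pairwise (· ≤ ·)) {A : ℕ}
    {f : Fin A → Fin a.length} (hf : Function.Injective f) :
    (a.take A).sum ≤ ∑ i, a.get (f i) := by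
  have hA : A ≤ a.length := by simpa using Fintype.card_le_of_injective f hf
  have hc : (Finset.univ.map ⟨f, hf⟩).card = A := by simp
  let e := (Finset.univ.map ⟨f, hf⟩).orderEmbOfFin hc
  have h1 : ∑ i, a.get (f i) = ∑ i, a.get (e i) := by
    have h2 : ∑ x ∈ Finset.univ.map ⟨f, hf⟩, a.get x = ∑ i, a.get (f i) := by
      rw [Finset.sum_map]; rfl
    have h3 : Finset.univ.map e.toEmbedding = Finset.univ.map ⟨f, hf⟩ :=
      Finset.map_orderEmbOfFin_univ _ hc
    rw [← h2, ← h3, Finset.sum_map]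
    rfl
  rw [h1, sum_take_eq_sum_fin hA]
  exact Finset.sum_le_sum fun i _ =>
    getElem_le_getElem ha (e i).2 (strictMono_le e.strictMono i)

/-- A sorted sub-multiset is a sublist, hence dominates the initial segment termwise; equal sums
leave no room for a strict inequality. -/
theorem eq_take_of_sum_eq {a b : List ℕ} (ha : a.Pairwise (· ≤ ·)) (hb : b.Pairwise (· ≤ ·))
    (hba : (b : Multiset ℕ) ≤ a) (hsum : b.sum = (a.take b.length).sum) :
    b = a.take b.length := by
  have hsub : b.Sublist a := List.sublist_of_subperm_of_pairwise (Multiset.coe_le.mp hba) hb ha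
  obtain ⟨f, hf⟩ := List.sublist_iff_exists_fin_orderEmbedding_get_eq.mp hsub
  have hle := hsub.length_le
  rw [sum_take_eq_sum_fin hle] at hsum
  have h1 : b.sum = ∑ i : Fin b.length, b[(i : ℕ)] := by
    conv_lhs => rw [← List.ofFn_getElem (xs := b), List.sum_ofFn]
  have h2 : ∀ i : Fin b.length, a[(i : ℕ)]'(by omega) ≤ b[(i : ℕ)] := fun i => by
    have h3 : b[(i : ℕ)] = a.get (f i) := hf i
    rw [h3]
    exact getElem_le_getElem ha (f i).2 (strictMono_le f.strictMono i)
  rw [h1] at hsum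
  have h4 := (Finset.sum_eq_sum_iff_of_le fun i _ => h2 i).mp hsum.symm
  apply List.ext_getElem
  · simp [hle]
  · intro i hi hi'
    rw [List.getElem_take]
    exact (h4 ⟨i, hi⟩ (Finset.mem_univ _)).symm

variable {α : Type*}

theorem filter_eq_take {l : List α} {A : ℕ} {P : α → Prop} [DecidablePred P]
    (h1 : ∀ x ∈ l.take A, P x) (h2 : ∀ x ∈ l.drop A, ¬ P x) : l.filter P = l.take A := by
  conv_lhs => rw [← List.take_append_drop A l]
  rw [List.filter_append, List.filter_eq_self.mpr (by simpa using h1),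
    List.filter_eq_nil_iff.mpr (by simpa using h2), List.append_nil]

theorem take_append_middlePart {l : List α} {A : ℕ} (hA : 2 * A ≤ l.length) :
    l = l.take A ++ (middlePart A l ++ l.drop (l.length - A)) := by
  have h1 : (l.take (l.length - A)).take A = l.take A := by
    rw [List.take_take, min_eq_left (by omega)]
  conv_lhs => rw [← List.take_append_drop (l.length - A) l,
    ← List.take_append_drop A (l.take (l.length - A)), h1, List.append_assoc]
  rfl

theorem outerPart_sublist {l : List α} {A : ℕ} (hA : 2 * A ≤ l.length) :
    (outerPart A l).Sublist l := by
  conv_rhs => rw [take_append_middlePart hA]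
  exact (List.Sublist.refl _).append (List.sublist_append_right _ _)

theorem middlePart_sublist (l : List α) (A : ℕ) : (middlePart A l).Sublist l :=
  (List.drop_sublist _ _).trans (List.take_sublist _ _)

theorem length_outerPart {l : List α} {A : ℕ} (hA : 2 * A ≤ l.length) :
    (outerPart A l).length = 2 * A := by
  simp only [outerPart, List.length_append, List.length_take, List.length_drop]
  omega

theorem length_middlePart (l : List α) (A : ℕ) :
    (middlePart A l).length = l.length - 2 * A := by
  simp only [middlePart, List.length_drop, List.length_take]
  omega

theorem mem_middlePart {l : List α} {A : ℕ} {x : α} (hx : x ∈ middlePart A l) :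
    x ∈ l.drop A ∧ x ∈ l.take (l.length - A) := by
  refine ⟨?_, List.mem_of_mem_drop hx⟩
  rw [middlePart, List.drop_take] at hx
  exact List.mem_of_mem_take hx

theorem filter_eq_outerPart {l : List α} {A : ℕ} (hA : 2 * A ≤ l.length) {P : α → Prop}
    [DecidablePred P] (h1 : ∀ x ∈ l.take A, P x) (h2 : ∀ x ∈ l.drop (l.length - A), P x)
    (h3 : ∀ x ∈ middlePart A l, ¬ P x) : l.filter P = outerPart A l := by
  conv_lhs => rw [take_append_middlePart hA]
  rw [List.filter_append, List.filter_append, List.filter_eq_self.mpr (by simpa using h1),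
    List.filter_eq_nil_iff.mpr (by simpa using h3), List.filter_eq_self.mpr (by simpa using h2)]
  rfl

theorem filter_eq_middlePart {l : List α} {A : ℕ} (hA : 2 * A ≤ l.length) {P : α → Prop}
    [DecidablePred P] (h1 : ∀ x ∈ l.take A, ¬ P x) (h2 : ∀ x ∈ l.drop (l.length - A), ¬ P x)
    (h3 : ∀ x ∈ middlePart A l, P x) : l.filter P = middlePart A l := by
  conv_lhs => rw [take_append_middlePart hA]
  rw [List.filter_append, List.filter_append, List.filter_eq_nil_iff.mpr (by simpa using h1),
    List.filter_eq_self.mpr (by simpa using h3), List.filter_eq_nil_iff.mpr (by simpa using h2)]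
  simp

theorem eq_reverse_map [PartialOrder α] {l : List α} {f : α → α} (hl : l.Pairwise (· ≤ ·))
    (hf : Antitone f) (h : (l : Multiset α) = (l : Multiset α).map f) : l = (l.map f).reverse := by
  refine List.Perm.eq_of_pairwise' hl ?_ ?_
  · rw [List.pairwise_reverse, List.pairwise_map]
    exact hl.imp fun h => hf h
  · rw [Multiset.map_coe, Multiset.coe_eq_coe] at h
    exact h.trans (List.reverse_perm _).symm

theorem take_of_eq_reverse_map {l : List α} {f : α → α} (h : l = (l.map f).reverse) (A : ℕ) :
    l.take (l.length - A) = ((l.drop A).map f).reverse := by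
  conv_lhs => rw [h, List.take_reverse]
  rcases le_total A l.length with hA | hA
  · simp [Nat.sub_sub_self hA]
  · simp [List.drop_eq_nil_of_le hA, Nat.sub_eq_zero_of_le hA]

theorem drop_of_eq_reverse_map {l : List α} {f : α → α} (h : l = (l.map f).reverse) (A : ℕ) :
    l.drop (l.length - A) = ((l.take A).map f).reverse := by
  conv_lhs => rw [h, List.drop_reverse]
  rcases le_total A l.length with hA | hA
  · simp [Nat.sub_sub_self hA]
  · simp [List.take_of_length_le hA, Nat.sub_eq_zero_of_le hA]

theorem polygon_succ_sub {l : List ℚ} {i : ℕ} (hi : i < l.length) :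
    polygon l (i + 1) - polygon l i = l[i] := by
  rw [polygon, polygon, List.sum_take_succ _ _ hi, add_sub_cancel_left]

/-- The slopes on the two sides of a break point. -/
theorem IsBreakPoint.exists_bound {l : List ℚ} {A : ℕ} {B : ℤ} (h : IsBreakPoint l A B)
    (hl : l.Pairwise (· ≤ ·)) :
    ∃ l₀ : ℚ, (∀ x ∈ l.take A, x ≤ l₀) ∧ ∀ x ∈ l.drop A, ¬ x ≤ l₀ := by
  obtain ⟨h0, h1, -, h2⟩ := h
  obtain ⟨A, rfl⟩ : ∃ A', A = A' + 1 := ⟨A - 1, by omega⟩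
  rw [polygon_succ_sub h1, Nat.add_sub_cancel, polygon_succ_sub (by omega)] at h2
  -- After the shift of `A` by one, this zero-based entry is the slope just to the left of the break
  -- point.
  refine ⟨l[A], fun x hx => ?_, fun x hx => ?_⟩
  · obtain ⟨i, hi, rfl⟩ := List.getElem_of_mem hx
    rw [List.getElem_take]
    rw [List.length_take] at hi
    exact getElem_le_getElem hl _ (by omega)
  · obtain ⟨i, hi, rfl⟩ := List.getElem_of_mem hx
    rw [List.getElem_drop, not_le]
    rw [List.length_drop] at hi
    exact (lt_of_le_of_ne (getElem_le_getElem hl h1 (by omega)) h2).trans_le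
      (getElem_le_getElem hl _ (by omega))

end Lists

variable {p : ℕ} [Fact p.Prime] {k : Type*} [Field k] [CharP k p] [PerfectRing k p]
variable {M : Type*} [AddCommGroup M] [Module (WittVector p k) M]
variable {N : Type*} [AddCommGroup N] [Module (WittVector p k) N]

theorem eq_of_isCompl_of_le {α : Type*} [Lattice α] [BoundedOrder α] [IsModularLattice α]
    {a b c d : α} (h : IsCompl a b) (h' : IsCompl c d) (hac : a ≤ c) (hbd : b ≤ d) : a = c := by
  refine eq_of_le_of_inf_le_of_sup_le (z := b) hac ?_ ?_
  · rw [(h'.disjoint.mono_right hbd).eq_bot]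
    exact bot_le
  · rw [h.sup_eq_top]
    exact le_top

theorem exists_hodgeBases (C : FCrystal p k M) :
    Nonempty (HodgeBases C (Fin (Module.finrank (WittVector p k) M))) := by
  have := C.free
  have := C.finite
  exact HodgeBases.exists_of_basis C (Module.finBasis _ _)

theorem SlopeDecomposition.card_slopes_eq_finrank {C : FCrystal p k M}
    (d : SlopeDecomposition C) :
    Multiset.card d.slopes = Module.finrank (WittVector p k) M := by
  obtain ⟨H⟩ := exists_hodgeBases C
  simpa using (H.sum_eq_sum_slopes d).2

namespace HodgeBases

variable {C : FCrystal p k M} {ι κ : Type*} [Fintype ι] [Fintype κ]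

/-- Hodge slopes of a direct sum. -/
theorem exists_slopes_add {E : FCrystal p k N} {g h : M →ₗ[WittVector p k] M}
    {hS : ∀ x ∈ LinearMap.range g, C.F x ∈ LinearMap.range g}
    {hT : ∀ x ∈ LinearMap.range h, C.F x ∈ LinearMap.range h}
    (H : HodgeBases (C.sub _ hS) ι) (H' : HodgeBases (C.sub _ hT) κ)
    (hg : ∀ x, g (g x) = g x) (hh : ∀ x, h (h x) = h x) (hgh : ∀ x, g (h x) = 0)
    (hhg : ∀ x, h (g x) = 0) (i : N →ₗ[WittVector p k] M) (r : M →ₗ[WittVector p k] N)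
    (hir : ∀ x, i (r x) = g x + h x) (hri : ∀ x, r (i x) = x)
    (hi : ∀ x, i (E.F x) = C.F (i x)) :
    ∃ H'' : HodgeBases E (ι ⊕ κ), H''.slopes = H.slopes + H'.slopes := by
  have hgx : ∀ x : LinearMap.range g, g x = x ∧ h x = 0 := by
    rintro ⟨_, x, rfl⟩
    exact ⟨hg x, hhg x⟩
  have hhx : ∀ x : LinearMap.range h, h x = x ∧ g x = 0 := by
    rintro ⟨_, x, rfl⟩
    exact ⟨hh x, hgh x⟩
  have hadd : ∀ (x : LinearMap.range g) (y : LinearMap.range h), i (r (x + y)) = x + y := by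
    intro x y
    rw [hir, map_add, map_add, (hgx x).1, (hgx x).2, (hhx y).1, (hhx y).2]
    simp
  -- The maps `i` and `r` identify `N` with the image of `g + h`; this covers both `N = M` and a
  -- proper summand.
  let e : (LinearMap.range g × LinearMap.range h) ≃ₗ[WittVector p k] N :=
    LinearEquiv.ofLinearMap
      (r ∘ₗ LinearMap.coprod (LinearMap.range g).subtype (LinearMap.range h).subtype)
      (LinearMap.prod g.rangeRestrict h.rangeRestrict ∘ₗ i)
      (by
        apply LinearMap.ext
        intro x
        change r (g (i x) + h (i x)) = x
        rw [← hir, hri, hri])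
      (by
        apply LinearMap.ext
        rintro ⟨x, y⟩
        have h1 : i (r (x + y)) = x + y := hadd x y
        apply Prod.ext
        · apply Subtype.ext
          change g (i (r (x + y))) = x
          rw [h1, map_add, (hgx x).1, (hhx y).2, add_zero]
        · apply Subtype.ext
          change h (i (r (x + y))) = y
          rw [h1, map_add, (hgx x).2, (hhx y).1, zero_add])
  have he : ∀ x y, E.F (e (x, y)) = e ((C.sub _ hS).F x, (C.sub _ hT).F y) := by
    intro x y
    apply (show Function.Injective i from Function.LeftInverse.injective hri)
    rw [hi]
    have h1 : i (e (x, y)) = x + y := hadd x y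
    have h2 : i (e ((C.sub _ hS).F x, (C.sub _ hT).F y)) = C.F x + C.F y := hadd _ _
    rw [h1, h2, map_add]
  refine ⟨⟨(H.v.prod H'.v).map e, (H.w.prod H'.w).map e, Sum.elim H.e H'.e, ?_⟩, ?_⟩
  · rintro (j | j)
    · simp only [Module.Basis.map_apply, Sum.elim_inl, ← map_smul]
      have h1 : (H.v.prod H'.v) (Sum.inl j) = (H.v j, 0) :=
        Prod.ext (Module.Basis.prod_apply_inl_fst _ _ _) (Module.Basis.prod_apply_inl_snd _ _ _)
      have h2 : (H.w.prod H'.w) (Sum.inl j) = (H.w j, 0) :=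
        Prod.ext (Module.Basis.prod_apply_inl_fst _ _ _) (Module.Basis.prod_apply_inl_snd _ _ _)
      rw [h1, h2, he, H.h, map_zero, Prod.smul_mk, smul_zero]
    · simp only [Module.Basis.map_apply, Sum.elim_inr, ← map_smul]
      have h1 : (H.v.prod H'.v) (Sum.inr j) = (0, H'.v j) :=
        Prod.ext (Module.Basis.prod_apply_inr_fst _ _ _) (Module.Basis.prod_apply_inr_snd _ _ _)
      have h2 : (H.w.prod H'.w) (Sum.inr j) = (0, H'.w j) :=
        Prod.ext (Module.Basis.prod_apply_inr_fst _ _ _) (Module.Basis.prod_apply_inr_snd _ _ _)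
      rw [h1, h2, he, H'.h, map_zero, Prod.smul_mk, smul_zero]
  · simp only [slopes]
    rw [← Finset.univ_disjSum_univ, Finset.val_disjSum, Multiset.disjSum, Multiset.map_add,
      Multiset.map_map, Multiset.map_map]
    rfl

/-- The truncated subtraction loses nothing, since matched slopes add up to exactly `D`. -/
theorem slopes_eq_map_of_pairing {E : FCrystal p k N} (H : HodgeBases C ι) (H' : HodgeBases E κ)
    (B : M ≃ₗ[WittVector p k] Module.Dual (WittVector p k) N) (D : ℕ) (u : (WittVector p k)ˣ)
    (hB : ∀ x y, B (C.F x) (E.F y) = (p : WittVector p k) ^ D * u * wittFrob p k (B x y)) :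
    H'.slopes = H.slopes.map (fun x => D - x) := by
  classical
  have f : κ ≃ ι := (H'.v.dualBasis.map B.symm).indexEquiv H.v
  obtain ⟨τ, hτ⟩ := H.slopes_of_pairing (H'.reindex f) B D u hB
  rw [← H'.slopes_reindex f, slopes, slopes, Multiset.map_map]
  refine (slopes_eq_of_perm (τ := τ) fun j => ?_).symm
  have := hτ j
  simp only [Function.comp_apply]
  omega

end HodgeBases

end

end NewtonHodge

end

/-! ### Assembly of the decomposition. -/

theorem mainTheorem1 (p : ℕ) [Fact p.Prime] (k : Type*) [Field k] [CharP k p] [PerfectRing k p]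
    (M : Type*) [AddCommGroup M] [Module (WittVector p k) M]
    (D : NewtonHodge.SelfDualFCrystal p k M)
    (n : ℕ) (hn : Module.finrank (WittVector p k) M = n)
    (a : List ℕ) (ha : NewtonHodge.IsHodgeSlopes D.toFCrystal a)
    (l : List ℚ) (hl : NewtonHodge.IsNewtonSlopes D.toFCrystal l)
    (A : ℕ) (B : ℤ) (hbreak : NewtonHodge.IsBreakPoint l A B)
    (hHodge : NewtonHodge.hodgePolygon a A = B)
    (hA : (A : ℚ) < (n : ℚ) / 2) :
    -- existence and uniqueness of the decomposition
    (∃ (S₁ S₂ : Submodule (WittVector p k) M)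
        (E₁ : NewtonHodge.SelfDualFCrystal p k S₁) (E₂ : NewtonHodge.SelfDualFCrystal p k S₂),
      NewtonHodge.IsSelfDualDecomposition D a l n A E₁ E₂ ∧
      NewtonHodge.IsOrthogonalSum D E₁ E₂ ∧
      ∀ (T₁ T₂ : Submodule (WittVector p k) M)
        (G₁ : NewtonHodge.SelfDualFCrystal p k T₁) (G₂ : NewtonHodge.SelfDualFCrystal p k T₂),
        NewtonHodge.IsSelfDualDecomposition D a l n A G₁ G₂ → T₁ = S₁ ∧ T₂ = S₂) ∧
    -- the filtration by perpendicular submodules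
    (∃ (M₁ M₂ : Submodule (WittVector p k) M)
        (C₁ : NewtonHodge.FCrystal p k M₁) (C₂ : NewtonHodge.FCrystal p k M₂),
      M₁ ≤ M₂ ∧
      (∃ N, IsCompl M₁ N) ∧ (∃ N, IsCompl M₂ N) ∧
      Module.finrank (WittVector p k) M₁ = A ∧
      Module.finrank (WittVector p k) M₂ = n - A ∧
      NewtonHodge.IsSubcrystal D.toFCrystal C₁ ∧
      NewtonHodge.IsSubcrystal D.toFCrystal C₂ ∧
      NewtonHodge.IsNewtonSlopes C₁ (l.take A) ∧
      NewtonHodge.IsNewtonSlopes C₂ (l.take (n - A)) ∧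
      ∀ x ∈ M₁, ∀ y ∈ M₂, D.Ψ x y = 0 ∧ D.Ψ y x = 0) := by
  classical
  open NewtonHodge in
  obtain ⟨hlsort, d, hd⟩ := (isNewtonSlopes_iff _ _).mp hl
  have hasort := ha.1
  obtain ⟨H, hHs, hHe⟩ := ha.exists_hodgeBases
  have hlen : l.length = n := by
    rw [← hn, ← d.card_slopes_eq_finrank, ← hd, Multiset.coe_card]
  have halen : a.length = n := by
    rw [← hn, Module.finrank_eq_card_basis H.v, Fintype.card_fin]
  have hAn : 2 * A < n := by
    have : (2 * A : ℚ) < n := by linarith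
    exact_mod_cast this
  have hAl : 2 * A ≤ l.length := by omega
  have hAa : 2 * A ≤ a.length := by omega
  obtain ⟨l₀, hlow, hhigh⟩ := hbreak.exists_bound hlsort
  obtain ⟨u, hu⟩ := D.exists_c_eq
  have hlsymm : l = (l.map fun t => (D.weight : ℚ) - t).reverse :=
    eq_reverse_map hlsort (fun x y hxy => sub_le_sub_left hxy _)
      (by rw [hd]; exact (D.newton_symm d).symm)
  have hasymm : a = (a.map fun t => D.weight - t).reverse := by
    refine eq_reverse_map hasort (fun x y hxy => Nat.sub_le_sub_left hxy _) ?_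
    rw [← hHs]
    exact H.slopes_eq_map_of_pairing H D.Ψ D.weight u fun x y => by rw [D.Ψ_frob, hu]
  have hlow' : ∀ x ∈ l.take (l.length - A), ¬ (D.weight : ℚ) - x ≤ l₀ := by
    intro x hx
    rw [take_of_eq_reverse_map hlsymm, List.mem_reverse, List.mem_map] at hx
    obtain ⟨y, hy, rfl⟩ := hx
    rw [sub_sub_cancel]
    exact hhigh y hy
  have hhigh' : ∀ x ∈ l.drop (l.length - A), (D.weight : ℚ) - x ≤ l₀ := by
    intro x hx
    rw [drop_of_eq_reverse_map hlsymm, List.mem_reverse, List.mem_map] at hx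
    obtain ⟨y, hy, rfl⟩ := hx
    rw [sub_sub_cancel]
    exact hlow y hy
  have hfl : l.filter (· ≤ l₀) = l.take A := filter_eq_take hlow hhigh
  have hsum_low : (l.take A).sum = ((a.take A).sum : ℕ) := by
    have h1 : (l.take A).sum = B := hbreak.2.2.1
    have h2 : ((a.map (Nat.cast : ℕ → ℚ)).take A).sum = B := by
      simpa [hodgePolygon, polygon, List.map_eq_flatMap] using hHodge
    rw [h1, ← h2, ← List.map_take, Nat.cast_list_sum]
  have hds : d.slopes.filter (· ≤ l₀) = (l.take A : List ℚ) := by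
    rw [← hd, Multiset.filter_coe, hfl]
  -- The contact of the polygons at `A` makes the sum of the small Newton slopes equal to the least
  -- sum of `A` Hodge slopes.
  obtain ⟨g, hg⟩ := d.exists_integral_proj H l₀ (fun f hf => by
    have hcard : Multiset.card (d.slopes.filter (· ≤ l₀)) = A := by
      rw [hds, Multiset.coe_card, List.length_take]; omega
    have h2 : (d.slopes.filter (· ≤ l₀)).sum =
        ((a.take (Multiset.card (d.slopes.filter (· ≤ l₀)))).sum : ℕ) := by
      rw [hcard, hds, Multiset.sum_coe, hsum_low]
    rw [h2, hHe]
    exact_mod_cast sum_take_le_sum hasort hf)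
  change d.IsForm (· ≤ l₀) g at hg
  obtain ⟨h, hh⟩ := D.exists_adjoint hg
  have hgh := D.Ψ_isForm hg hh
  have hm := hg.compl.comp hh.compl
  set gm := (LinearMap.id - g) ∘ₗ (LinearMap.id - h) with hgm
  have ho : d.IsForm (fun x => x ≤ l₀ ∨ (D.weight : ℚ) - x ≤ l₀) (LinearMap.id - gm) :=
    hm.compl.congr fun x => by tauto
  set go := LinearMap.id - gm with hgo
  -- Both slope conditions are invariant under reflection, so both idempotents are self-adjoint.
  have hoΨ := D.Ψ_isForm ho (ho.congr fun x => by rw [sub_sub_cancel]; exact or_comm)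
  have hmΨ := D.Ψ_isForm hm (hm.congr fun x => by rw [sub_sub_cancel]; exact and_comm)
  have hfo : l.filter (fun x => x ≤ l₀ ∨ (D.weight : ℚ) - x ≤ l₀) = outerPart A l :=
    filter_eq_outerPart hAl (fun x hx => Or.inl (hlow x hx)) (fun x hx => Or.inr (hhigh' x hx))
      fun x hx => not_or.mpr ⟨hhigh x (mem_middlePart hx).1, hlow' x (mem_middlePart hx).2⟩
  have hfm : l.filter (fun x => ¬ x ≤ l₀ ∧ ¬ (D.weight : ℚ) - x ≤ l₀) = middlePart A l :=
    filter_eq_middlePart hAl (fun x hx h => h.1 (hlow x hx)) (fun x hx h => h.2 (hhigh' x hx))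
      fun x hx => ⟨hhigh x (mem_middlePart hx).1, hlow' x (mem_middlePart hx).2⟩
  let E₁ := D.restrict ho.idem ho.stable ho.frob hoΨ
  let E₂ := D.restrict hm.idem hm.stable hm.frob hmΨ
  have hN₁ : IsNewtonSlopes E₁.toFCrystal (outerPart A l) := hfo ▸ ho.isNewtonSlopes hlsort hd
  have hN₂ : IsNewtonSlopes E₂.toFCrystal (middlePart A l) := hfm ▸ hm.isNewtonSlopes hlsort hd
  have hrank : ∀ {S : Submodule (WittVector p k) M} {E : FCrystal p k S} {l' : List ℚ},
      IsNewtonSlopes E l' → Module.finrank (WittVector p k) S = l'.length := by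
    intro S E l' hl'
    obtain ⟨-, d', hd'⟩ := (isNewtonSlopes_iff _ _).mp hl'
    rw [← d'.card_slopes_eq_finrank, ← hd', Multiset.coe_card]
  -- A middle slope exists because `2 * A < n`; it and its reflection both exceed `l₀`, so the
  -- weight exceeds `2 * l₀` and the two outer slope ranges are disjoint.
  have hweight : ∀ x, ¬ (x ≤ l₀ ∧ (D.weight : ℚ) - x ≤ l₀) := by
    obtain ⟨y, hy⟩ := List.exists_mem_of_length_pos
      (l := middlePart A l) (by rw [length_middlePart]; omega)
    have h1 := hhigh y (mem_middlePart hy).1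
    have h2 := hlow' y (mem_middlePart hy).2
    rintro x ⟨h3, h4⟩
    linarith
  have hgh0 : ∀ x, g (h x) = 0 := fun x => by
    have := LinearMap.congr_fun (((hg.compl.comp hh).congr fun t => by
      have := hweight t; tauto).unique hh) x
    simpa using this
  have hhg0 : ∀ x, h (g x) = 0 := fun x => by
    have := LinearMap.congr_fun (((hh.compl.comp hg).congr fun t => by
      have := hweight t; tauto).unique hg) x
    simpa using this
  have hgoadd : ∀ x, go x = g x + h x := fun x => by
    simp only [hgo, hgm, LinearMap.sub_apply, LinearMap.comp_apply, LinearMap.id_apply, map_sub,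
      hgh0]
    abel
  obtain ⟨H₁⟩ := exists_hodgeBases (D.toFCrystal.sub _ hg.stable)
  obtain ⟨H₁'⟩ := exists_hodgeBases (D.toFCrystal.sub _ hg.compl.stable)
  obtain ⟨H₃⟩ := exists_hodgeBases (D.toFCrystal.sub _ hh.stable)
  obtain ⟨Ho⟩ := exists_hodgeBases E₁.toFCrystal
  obtain ⟨Hm⟩ := exists_hodgeBases E₂.toFCrystal
  -- These slopes form a sub-multiset of `a` of size `A`, and equality of end points gives it the
  -- sum of the first `A` entries.
  have hH₁ : H₁.slopes = (a.take A : List ℕ) := by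
    obtain ⟨H', hH'⟩ := H₁.exists_slopes_add (E := D.toFCrystal) H₁' hg.idem hg.compl.idem
      (fun x => by simp [hg.idem]) (fun x => by simp [hg.idem]) LinearMap.id LinearMap.id
      (fun x => by simp) (fun x => rfl) (fun x => rfl)
    rw [H'.slopes_unique H, hHs] at hH'
    obtain ⟨d₁, hd₁⟩ := hg.exists_slopes
    obtain ⟨hs, hc⟩ := H₁.sum_eq_sum_slopes d₁
    rw [hd₁, hds] at hs hc
    have hb : ((H₁.slopes.sort (· ≤ ·) : List ℕ) : Multiset ℕ) = H₁.slopes := Multiset.sort_eq _ _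
    have hblen : (H₁.slopes.sort (· ≤ ·)).length = A := by
      rw [Multiset.length_sort, HodgeBases.slopes, Multiset.card_map]
      rw [Finset.card_val, Finset.card_univ, ← hc, Multiset.coe_card, List.length_take]
      omega
    have := eq_take_of_sum_eq hasort (Multiset.pairwise_sort _ _)
      (by rw [hb, hH']; exact Multiset.le_add_right _ _) (by
        rw [hblen, ← Multiset.sum_coe, hb]
        rw [Multiset.sum_coe, hsum_low] at hs
        exact_mod_cast hs)
    rw [hblen] at this
    rw [← hb, this]
  -- The images of `g` and `h` are in perfect duality, and `a` is symmetric.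
  have hH₃ : H₃.slopes = (a.drop (a.length - A) : List ℕ) := by
    rw [H₁.slopes_eq_map_of_pairing H₃ (SelfDualFCrystal.rangePairing hg.idem hh.idem hgh) D.weight
      u (fun x y => (D.Ψ_frob x y).trans (by rw [hu]; rfl)), hH₁, drop_of_eq_reverse_map hasymm,
      Multiset.map_coe, Multiset.coe_eq_coe]
    exact (List.reverse_perm _).symm
  have hHo : Ho.slopes = (outerPart A a : List ℕ) := by
    obtain ⟨H', hH'⟩ := H₁.exists_slopes_add (E := E₁.toFCrystal) H₃ hg.idem hh.idem hgh0 hhg0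
      (LinearMap.range go).subtype go.rangeRestrict hgoadd
      (fun x => Subtype.ext (ho.mem_range.mp x.2)) (fun x => rfl)
    rw [Ho.slopes_unique H', hH', hH₁, hH₃, Multiset.coe_add]
    rfl
  have hHm : Hm.slopes = (middlePart A a : List ℕ) := by
    obtain ⟨H', hH'⟩ := Ho.exists_slopes_add (E := D.toFCrystal) (C := D.toFCrystal)
      (hS := ho.stable) (hT := hm.stable) Hm ho.idem hm.idem
      (fun x => by simp [hgo, hm.idem]) (fun x => by simp [hgo, hm.idem]) LinearMap.id LinearMap.id
      (fun x => by simp [hgo]) (fun x => rfl) (fun x => rfl)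
    rw [H'.slopes_unique H, hHs] at hH'
    have hH'' : (a : Multiset ℕ) = Ho.slopes + Hm.slopes := hH'
    rw [hHo] at hH''
    have h1 : (a : Multiset ℕ) = (outerPart A a : List ℕ) + (middlePart A a : List ℕ) := by
      conv_lhs => rw [take_append_middlePart hAa]
      rw [outerPart, ← Multiset.coe_add, ← Multiset.coe_add, ← Multiset.coe_add]
      abel
    exact add_left_cancel (hH''.symm.trans h1)
  have hcompl : IsCompl (LinearMap.range go) (LinearMap.range gm) :=
    ho.isCompl (hm.congr fun x => by tauto)
  refine ⟨⟨LinearMap.range go, LinearMap.range gm, E₁, E₂, ?_, ?_, ?_⟩, ?_⟩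
  · exact
      { isCompl := hcompl
        sub₁ := fun x => rfl
        sub₂ := fun x => rfl
        c₁ := rfl
        c₂ := rfl
        rank₁ := by rw [hrank hN₁, length_outerPart hAl]
        rank₂ := by rw [hrank hN₂, length_middlePart, hlen]
        hodge₁ := Ho.isHodgeSlopes (hasort.sublist (outerPart_sublist hAa)) hHo.symm
        newton₁ := hN₁
        hodge₂ := Hm.isHodgeSlopes (hasort.sublist (middlePart_sublist a A)) hHm.symm
        newton₂ := hN₂ }
  · have horth : ∀ x, go (gm x) = 0 := fun x => by simp [hgo, hm.idem]
    have horth' : ∀ x, gm (go x) = 0 := fun x => by simp [hgo, hm.idem]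
    refine ⟨fun x y => rfl, fun x y => rfl, ?_, ?_⟩
    · rintro _ ⟨x, rfl⟩ _ ⟨y, rfl⟩
      rw [hoΨ, horth, map_zero]
    · rintro _ ⟨x, rfl⟩ _ ⟨y, rfl⟩
      rw [hmΨ, horth', map_zero]
  · intro T₁ T₂ G₁ G₂ hT
    obtain ⟨-, d₁, hd₁⟩ := (isNewtonSlopes_iff _ _).mp hT.newton₁
    obtain ⟨-, d₂, hd₂⟩ := (isNewtonSlopes_iff _ _).mp hT.newton₂
    -- The Newton slopes alone force the inclusions; complementarity turns them into equalities.
    have hle₁ : T₁ ≤ LinearMap.range go := ho.le_range hT.sub₁ d₁ fun x hx => by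
      rw [← hd₁, ← hfo, Multiset.mem_coe, List.mem_filter] at hx
      simpa using hx.2
    have hle₂ : T₂ ≤ LinearMap.range gm := hm.le_range hT.sub₂ d₂ fun x hx => by
      rw [← hd₂, ← hfm, Multiset.mem_coe, List.mem_filter] at hx
      simpa using hx.2
    exact ⟨eq_of_isCompl_of_le hT.isCompl hcompl hle₁ hle₂,
      eq_of_isCompl_of_le hT.isCompl.symm hcompl.symm hle₂ hle₁⟩
  -- The filtration consists of the image of `g` and the kernel of its adjoint `h`, written as the
  -- image of `1 - h`; perpendicularity is adjointness.
  · have hM₁ : LinearMap.range g ≤ LinearMap.range (LinearMap.id - h) := by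
      rintro _ ⟨x, rfl⟩
      exact ⟨g x, by simp [hhg0]⟩
    have hN₁' : IsNewtonSlopes (D.toFCrystal.sub _ hg.stable) (l.take A) :=
      hfl ▸ hg.isNewtonSlopes hlsort hd
    have hfl' : l.filter (fun x => ¬ (D.weight : ℚ) - x ≤ l₀) = l.take (n - A) := by
      rw [← hlen]
      exact filter_eq_take hlow' fun x hx => not_not.mpr (hhigh' x hx)
    have hN₂' : IsNewtonSlopes (D.toFCrystal.sub _ hh.compl.stable) (l.take (n - A)) :=
      hfl' ▸ hh.compl.isNewtonSlopes hlsort hd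
    have hgh' := D.Ψ_isForm hh (hg.congr fun x => by rw [sub_sub_cancel])
    refine ⟨_, _, D.toFCrystal.sub _ hg.stable, D.toFCrystal.sub _ hh.compl.stable, hM₁,
      ⟨_, hg.isCompl hg.compl⟩, ⟨_, (hh.isCompl hh.compl).symm⟩, ?_, ?_, fun x => rfl, fun x => rfl,
      hN₁', hN₂', ?_⟩
    · rw [hrank hN₁', List.length_take]
      omega
    · rw [hrank hN₂', List.length_take]
      omega
    · rintro _ ⟨x, rfl⟩ _ ⟨y, rfl⟩
      constructor
      · rw [hgh]
        simp [hh.idem]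
      · have hy : h (y - h y) = 0 := by rw [map_sub, hh.idem, sub_self]
        rw [← hgh', LinearMap.sub_apply, LinearMap.id_apply, hy, map_zero, LinearMap.zero_apply]
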